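/- Let $a_1,a_2,a_3,a_4\in\mathbb R$ with $a_1a_4=a_2a_3$. Let $G$ be a $6$-dimensional Lie group with a basis $e_1,\dots,e_5,A_2$ of its left invariant $1$-forms satisfying $$\begin{aligned} de_1&=A_2\wedge e_2-(2a_1+a_3)\,e_3\wedge e_5-(2a_2+a_4)\,e_4\wedge e_5,\\ de_2&=-A_2\wedge e_1+(2a_1+a_3)\,e_4\wedge e_5-(2a_2+a_4)\,e_3\wedge e_5,\\ de_3&=-A_2\wedge e_4+(2a_1+a_3)\,e_1\wedge e_5+(2a_2+a_4)\,e_2\wedge e_5,\\ de_4&=A_2\wedge e_3-(2a_1+a_3)\,e_2\wedge e_5+(2a_2+a_4)\,e_1\wedge e_5,\\ de_5&=-2(a_1-a_3)(e_1\wedge e_3-e_2\wedge e_4)-2(a_2-a_4)(e_1\wedge e_4+e_2\wedge e_3),\\ dA_2&=-2\big((a_1-a_3)(2a_1+a_3)+(a_2-a_4)(2a_2+a_4)\big)(e_1\wedge e_2-e_3\wedge e_4). \end{aligned}$$ Let $M^5$ be a nonempty $5$-dimensional (injectively immersed) submanifold of $G$ on which the restrictions of $e_1,\dots,e_5$ are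 linearly independent at every point. Denote by $M^5(a_1,a_2,a_3,a_4)$ the manifold $M^5$ with the almost contact metric structure $(g,\xi,\eta,\varphi)$ for which $(e_1,\dots,e_5)$ is an adapted frame, i.e. $g=\sum_i e_i\otimes e_i$, $\eta=g(\xi,\cdot)=e_5$ and $\Phi:=g(\cdot,\varphi\,\cdot)=e_1\wedge e_2+e_3\wedge e_4$. For an almost contact metric $5$-manifold, the intrinsic torsion is $\Gamma(X)=\mathrm{pr}_{\mathfrak u(2)^\perp}\big(\Omega^g(X)\big)$. Here $\Omega^g=(\omega^g_{ij})$, $\omega^g_{ij}=g(\nabla^g e_i,e_j)$, are the connection forms of the Levi-Civita connection $\nabla^g$ with respect to (local) adapted frames, $\mathfrak{so}(5)$ is identified with $\Lambda^2$, and $\mathfrak u(2)^\perp$ is the orthogonal complement in $\mathfrak{so}(5)$ of the Lie algebra $\mathfrak u(2)$ of the stabilizer of $\eta$ and $\Phi$, with respect to $\langle x,y\rangle=-\tfrac12\mathrm{tr}(xy)$. Put $$\Lambda^2_2=\{\beta\in\Lambda^2 : \Phi\wedge\beta=0,\ \ast\beta=\eta\wedge\beta\},$$ $$\mathcal W_4=\{\ast\beta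 : \beta\in\Lambda^2_2\},\qquad \mathcal W_7=\{3\,\eta\otimes\beta-\ast\beta : \beta\in\Lambda^2_2\},$$ both regarded as subspaces of $\Lambda^1\otimes\Lambda^2$. The manifold is said to be of class $\mathcal W$ if $\Gamma\in\mathcal W$ at every point. Then $M^5(a_1,a_2,a_3,a_4)$ is of class $\mathcal W_4\oplus\mathcal W_7$. Moreover, it is of class $\mathcal W_4$ if and only if $a_3=a_4=0$, and it is of class $\mathcal W_7$ if and only if $a_1=a_2=0$. -/

import Mathlib

open scoped Manifold ContDiff Matrix
open Bundle

noncomputable section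

namespace AlmostContact

/-! ### Linear algebra of `ℝ⁵` with its standard `U(2)`-structure

Indices are `0,…,4` instead of `1,…,5`. A `2`-form `β` on `ℝ⁵` is the skew-symmetric matrix of its
components `β i j = β(eᵢ, eⱼ)`; this is the identification of `Λ²` with `so(5)`. -/

/-- Real `5 × 5` matrices. -/
abbrev Mat5 : Type := Matrix (Fin 5) (Fin 5) ℝ

/-- Components `A i j k = A(eᵢ, eⱼ, eₖ)` of covariant `3`-tensors on `ℝ⁵`. An element of
`Λ¹ ⊗ Λ²` is such a tensor for which every matrix `A i` is skew-symmetric. -/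
abbrev Tensor3 : Type := Fin 5 → Fin 5 → Fin 5 → ℝ

/-- The space `Λ²` of `2`-forms on `ℝ⁵`, i.e. the Lie algebra `so(5)`. -/
def twoForms : Submodule ℝ Mat5 where
  carrier := {β | βᵀ = -β}
  add_mem' := by
    intro β γ hβ hγ
    simp only [Set.mem_ofPred_eq] at *
    rw [Matrix.transpose_add, hβ, hγ, neg_add]
  zero_mem' := by simp
  smul_mem' := by
    intro c β hβ
    simp only [Set.mem_ofPred_eq] at *
    rw [Matrix.transpose_smul, hβ, smul_neg]

/-- The `2`-form `Φ = e₁ ∧ e₂ + e₃ ∧ e₄`. -/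
def Phi0 : Mat5 :=
  !![0, 1, 0, 0, 0;
     -1, 0, 0, 0, 0;
     0, 0, 0, 1, 0;
     0, 0, -1, 0, 0;
     0, 0, 0, 0, 0]

/-- The `1`-form `η = e₅`. -/
def eta0 : Fin 5 → ℝ := ![0, 0, 0, 0, 1]

/-- The totally antisymmetric symbol: the sign of `f` if `f` is a permutation of the five indices
and `0` otherwise. -/
def epsilon (f : Fin 5 → Fin 5) : ℤ :=
  ∏ r : Fin 5, ∏ s ∈ Finset.Ioi r, Int.sign (((f s : ℕ) : ℤ) - ((f r : ℕ) : ℤ))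

/-- The Hodge operator from `2`-forms to `3`-forms on the oriented Euclidean space `ℝ⁵`. -/
def hodge : Mat5 →ₗ[ℝ] Tensor3 where
  toFun β i j k := (1 / 2) * ∑ l, ∑ m, (epsilon ![l, m, i, j, k] : ℝ) * β l m
  map_add' β γ := by
    funext i j k
    simp only [Matrix.add_apply, mul_add, Finset.sum_add_distrib, Pi.add_apply]
  map_smul' c β := by
    funext i j k
    simp only [Matrix.smul_apply, smul_eq_mul, Pi.smul_apply, RingHom.id_apply, Finset.mul_sum]
    exact Finset.sum_congr rfl fun l _ => Finset.sum_congr rfl fun m _ => by ring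

/-- The `3`-form `η ∧ β` for a `2`-form `β`. -/
def etaWedge : Mat5 →ₗ[ℝ] Tensor3 where
  toFun β i j k := eta0 i * β j k + eta0 j * β k i + eta0 k * β i j
  map_add' β γ := by
    funext i j k
    simp only [Matrix.add_apply, Pi.add_apply]
    ring
  map_smul' c β := by
    funext i j k
    simp only [Matrix.smul_apply, smul_eq_mul, Pi.smul_apply, RingHom.id_apply]
    ring

/-- The `4`-form `Φ ∧ β` for a `2`-form `β`. -/
def phiWedge : Mat5 →ₗ[ℝ] (Fin 5 → Fin 5 → Fin 5 → Fin 5 → ℝ) where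
  toFun β i j k l :=
    Phi0 i j * β k l - Phi0 i k * β j l + Phi0 i l * β j k
      + Phi0 j k * β i l - Phi0 j l * β i k + Phi0 k l * β i j
  map_add' β γ := by
    funext i j k l
    simp only [Matrix.add_apply, Pi.add_apply]
    ring
  map_smul' c β := by
    funext i j k l
    simp only [Matrix.smul_apply, smul_eq_mul, Pi.smul_apply, RingHom.id_apply]
    ring

/-- `Λ²₂ = {β ∈ Λ² | Φ ∧ β = 0, ∗β = η ∧ β}`. -/
def Lambda22 : Submodule ℝ Mat5 :=
  twoForms ⊓ LinearMap.ker phiWedge ⊓ LinearMap.eqLocus hodge etaWedge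

/-- `θ(β)(X,Y,Z) = ∗β(X,Y,Z)`. -/
def theta : Mat5 →ₗ[ℝ] Tensor3 := hodge

/-- `η ⊗ β`, i.e. `(X,Y,Z) ↦ η(X) β(Y,Z)`. -/
def etaTensor : Mat5 →ₗ[ℝ] Tensor3 where
  toFun β i j k := eta0 i * β j k
  map_add' β γ := by
    funext i j k
    simp only [Matrix.add_apply, Pi.add_apply]
    ring
  map_smul' c β := by
    funext i j k
    simp only [Matrix.smul_apply, smul_eq_mul, Pi.smul_apply, RingHom.id_apply]
    ring

/-- `ϑ(β)(X,Y,Z) = 3 η(X) β(Y,Z) - ∗β(X,Y,Z)`. -/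
def vartheta : Mat5 →ₗ[ℝ] Tensor3 := (3 : ℝ) • etaTensor - hodge

/-- The module `𝒲₄ = θ(Λ²₂)` of intrinsic torsion tensors. -/
def W4 : Submodule ℝ Tensor3 := Lambda22.map theta

/-- The module `𝒲₇ = ϑ(Λ²₂)` of intrinsic torsion tensors. -/
def W7 : Submodule ℝ Tensor3 := Lambda22.map vartheta

/-- The Lie algebra `u(2) ⊂ so(5)` of the stabilizer of `Φ` and `η`. (An element of `so(5)` that
commutes with `Φ` automatically kills `e₅`.) -/
def u2 : Submodule ℝ Mat5 where
  carrier := {A | A ∈ twoForms ∧ A * Phi0 = Phi0 * A}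
  add_mem' := by
    rintro A B ⟨hA, hA'⟩ ⟨hB, hB'⟩
    exact ⟨twoForms.add_mem hA hB, by rw [add_mul, mul_add, hA', hB']⟩
  zero_mem' := ⟨twoForms.zero_mem, by simp⟩
  smul_mem' := by
    rintro c A ⟨hA, hA'⟩
    exact ⟨twoForms.smul_mem c hA, by rw [smul_mul_assoc, mul_smul_comm, hA']⟩

/-- The projection of `so(5)` onto the orthogonal complement of `u(2)` with respect to
`⟨x, y⟩ = -(1/2) tr (x y)`; see `sub_prU2Perp_mem` and `trace_prU2Perp_mul`. -/
def prU2Perp (A : Mat5) : Mat5 :=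
  A - (1 / 2 : ℝ) • (Phi0 * Phi0 * A * (Phi0 * Phi0) - Phi0 * A * Phi0)

theorem phi0_transpose : Phi0ᵀ = -Phi0 := by
  ext i j
  fin_cases i <;> fin_cases j <;> simp [Phi0]

theorem phi0_cube : Phi0 * Phi0 * Phi0 = -Phi0 := by
  ext i j
  fin_cases i <;> fin_cases j <;> simp [Phi0, Matrix.mul_apply, Fin.sum_univ_five]

theorem mem_twoForms {A : Mat5} : A ∈ twoForms ↔ Aᵀ = -A :=
  Iff.rfl

theorem sub_prU2Perp_mem {A : Mat5} (hA : A ∈ twoForms) : A - prU2Perp A ∈ u2 := by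
  have e : A - prU2Perp A
      = (1 / 2 : ℝ) • (Phi0 * Phi0 * A * (Phi0 * Phi0) - Phi0 * A * Phi0) := by
    simp [prU2Perp]
  rw [mem_twoForms] at hA
  rw [e]
  refine u2.smul_mem _ ⟨?_, ?_⟩
  · rw [mem_twoForms]
    simp only [Matrix.transpose_sub, Matrix.transpose_mul, phi0_transpose, hA]
    noncomm_ring
  · have h1 : Phi0 * Phi0 * A * (Phi0 * Phi0) * Phi0 = -(Phi0 * Phi0 * A * Phi0) := by
      rw [mul_assoc _ (Phi0 * Phi0) Phi0, phi0_cube, mul_neg]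
    have h2 : Phi0 * (Phi0 * Phi0 * A * (Phi0 * Phi0)) = -(Phi0 * A * (Phi0 * Phi0)) := by
      have : Phi0 * (Phi0 * Phi0) = -Phi0 := by rw [← mul_assoc, phi0_cube]
      rw [← mul_assoc, ← mul_assoc Phi0 (Phi0 * Phi0) A, this, neg_mul, neg_mul]
    rw [sub_mul, mul_sub, h1, h2]
    noncomm_ring

theorem u2_mul_phi0_sq {B : Mat5} (hB : B ∈ u2) : B * (Phi0 * Phi0) = -B := by
  obtain ⟨hs, hc⟩ := hB
  rw [mem_twoForms] at hs
  have hs' : ∀ i j, B j i = -B i j := fun i j => congrFun (congrFun hs i) j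
  have hc' : ∀ i j, (B * Phi0) i j = (Phi0 * B) i j := fun i j => by rw [hc]
  have h0 : B 0 4 = 0 := by
    have := hc' 1 4; simpa [Phi0, Matrix.mul_apply, Fin.sum_univ_five] using this
  have h1 : B 1 4 = 0 := by
    have := hc' 0 4; simpa [Phi0, Matrix.mul_apply, Fin.sum_univ_five] using this.symm
  have h2 : B 2 4 = 0 := by
    have := hc' 3 4; simpa [Phi0, Matrix.mul_apply, Fin.sum_univ_five] using this
  have h3 : B 3 4 = 0 := by
    have := hc' 2 4; simpa [Phi0, Matrix.mul_apply, Fin.sum_univ_five] using this.symm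
  have h4 : B 4 4 = 0 := by linarith [hs' 4 4]
  ext i j
  fin_cases j <;> fin_cases i <;>
    simp [Phi0, Matrix.mul_apply, Fin.sum_univ_five, h0, h1, h2, h3, h4]

theorem trace_prU2Perp_mul (A : Mat5) {B : Mat5} (hB : B ∈ u2) :
    (prU2Perp A * B).trace = 0 := by
  have hsq := u2_mul_phi0_sq hB
  have hc := hB.2
  have h1 : (Phi0 * Phi0 * A * (Phi0 * Phi0) * B).trace = (A * B).trace := by
    have : Phi0 * Phi0 * B = -B := by rw [mul_assoc, ← hc, ← mul_assoc, ← hc, mul_assoc, hsq]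
    have h : Phi0 * Phi0 * A * (Phi0 * Phi0) * B = -((Phi0 * Phi0) * (A * B)) := by
      rw [mul_assoc _ (Phi0 * Phi0) B, this, mul_neg, mul_assoc]
    rw [h, Matrix.trace_neg, Matrix.trace_mul_comm, mul_assoc, hsq, mul_neg, Matrix.trace_neg,
      neg_neg]
  have h2 : (Phi0 * A * Phi0 * B).trace = -(A * B).trace := by
    rw [mul_assoc, ← hc, mul_assoc, Matrix.trace_mul_comm, mul_assoc, mul_assoc, hsq, mul_neg,
      Matrix.trace_neg]
  rw [prU2Perp, sub_mul, smul_mul_assoc, sub_mul, Matrix.trace_sub, Matrix.trace_smul,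
    Matrix.trace_sub, h1, h2]
  simp only [smul_eq_mul]
  ring

/-! ### One-forms on manifolds and their exterior derivative -/

/-- The model space `ℝⁿ`. -/
abbrev Euc (n : ℕ) : Type := EuclideanSpace ℝ (Fin n)

section OneForms

variable {n : ℕ} {N : Type*} [TopologicalSpace N] [ChartedSpace (Euc n) N]

/-- The expression of a `1`-form in the chart at `x`, i.e. its pull-back by the inverse chart. -/
def formInChart (α : ∀ y : N, TangentSpace (𝓡 n) y →L[ℝ] ℝ) (x : N) (u : Euc n) :
    Euc n [⋀^Fin 1]→L[ℝ] ℝ :=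
  ContinuousAlternatingMap.ofSubsingleton ℝ (Euc n) ℝ (0 : Fin 1)
    ((α ((extChartAt (𝓡 n) x).symm u)).comp
      (mfderiv 𝓘(ℝ, Euc n) (𝓡 n) (extChartAt (𝓡 n) x).symm u))

/-- The exterior derivative `dα` of a `1`-form on a manifold, computed in the chart at the given
point: `dα(v, w) = extDerivOne α x v w`. -/
def extDerivOne (α : ∀ y : N, TangentSpace (𝓡 n) y →L[ℝ] ℝ) (x : N)
    (v w : TangentSpace (𝓡 n) x) : ℝ :=
  extDeriv (formInChart α x) (extChartAt (𝓡 n) x x)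
    ![mfderiv (𝓡 n) 𝓘(ℝ, Euc n) (extChartAt (𝓡 n) x) x v,
      mfderiv (𝓡 n) 𝓘(ℝ, Euc n) (extChartAt (𝓡 n) x) x w]

/-- `(α ∧ β)(v, w)` for two linear forms. -/
def wedge {V : Type*} [AddCommGroup V] [Module ℝ V] [TopologicalSpace V]
    (α β : V →L[ℝ] ℝ) (v w : V) : ℝ :=
  α v * β w - α w * β v

end OneForms

/-- The pull-back of a `1`-form under a map from an `m`-manifold to an `n`-manifold. -/
def pullbackForm (m n : ℕ) {M N : Type*} [TopologicalSpace M] [ChartedSpace (Euc m) M]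
    [TopologicalSpace N] [ChartedSpace (Euc n) N] (f : M → N)
    (α : ∀ y : N, TangentSpace (𝓡 n) y →L[ℝ] ℝ) (x : M) : TangentSpace (𝓡 m) x →L[ℝ] ℝ :=
  (α (f x)).comp (mfderiv (𝓡 m) (𝓡 n) f x)

section LieGroups

variable (n : ℕ) (G : Type*) [TopologicalSpace G] [ChartedSpace (Euc n) G] [Group G]

/-- The space of left invariant `1`-forms on a Lie group. -/
def leftInvariantForms : Submodule ℝ (∀ y : G, TangentSpace (𝓡 n) y →L[ℝ] ℝ) where
  carrier := {α | ∀ g h : G, (α (g * h)).comp (mfderiv (𝓡 n) (𝓡 n) (fun y : G => g * y) h) = α h}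
  add_mem' := by
    intro α τ hα hτ g h
    change (α (g * h) + τ (g * h)).comp _ = α h + τ h
    rw [ContinuousLinearMap.add_comp, hα, hτ]
  zero_mem' := fun g h => ContinuousLinearMap.zero_comp _
  smul_mem' := by
    intro c α hα g h
    change (c • α (g * h)).comp _ = c • α h
    rw [ContinuousLinearMap.smul_comp, hα]

end LieGroups

/-- The structure equations satisfied by the left invariant `1`-forms `e₁, …, e₅` and `A₂`. -/
structure StructureEquations (a₁ a₂ a₃ a₄ : ℝ) {G : Type*} [TopologicalSpace G]
    [ChartedSpace (Euc 6) G] (e : Fin 5 → ∀ y : G, TangentSpace (𝓡 6) y →L[ℝ] ℝ)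
    (A : ∀ y : G, TangentSpace (𝓡 6) y →L[ℝ] ℝ) : Prop where
  d_e₁ : ∀ y, extDerivOne (e 0) y = wedge (A y) (e 1 y)
    - (2 * a₁ + a₃) • wedge (e 2 y) (e 4 y) - (2 * a₂ + a₄) • wedge (e 3 y) (e 4 y)
  d_e₂ : ∀ y, extDerivOne (e 1) y = -wedge (A y) (e 0 y)
    + (2 * a₁ + a₃) • wedge (e 3 y) (e 4 y) - (2 * a₂ + a₄) • wedge (e 2 y) (e 4 y)
  d_e₃ : ∀ y, extDerivOne (e 2) y = -wedge (A y) (e 3 y)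
    + (2 * a₁ + a₃) • wedge (e 0 y) (e 4 y) + (2 * a₂ + a₄) • wedge (e 1 y) (e 4 y)
  d_e₄ : ∀ y, extDerivOne (e 3) y = wedge (A y) (e 2 y)
    - (2 * a₁ + a₃) • wedge (e 1 y) (e 4 y) + (2 * a₂ + a₄) • wedge (e 0 y) (e 4 y)
  d_e₅ : ∀ y, extDerivOne (e 4) y =
    -(2 * (a₁ - a₃)) • (wedge (e 0 y) (e 2 y) - wedge (e 1 y) (e 3 y))
    - (2 * (a₂ - a₄)) • (wedge (e 0 y) (e 3 y) + wedge (e 1 y) (e 2 y))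
  d_A₂ : ∀ y, extDerivOne A y =
    (-2 * ((a₁ - a₃) * (2 * a₁ + a₃) + (a₂ - a₄) * (2 * a₂ + a₄))) •
      (wedge (e 0 y) (e 1 y) - wedge (e 2 y) (e 3 y))

/-! ### Almost contact metric `5`-manifolds -/

section Manifolds

variable (M : Type*) [TopologicalSpace M] [ChartedSpace (Euc 5) M] [IsManifold (𝓡 5) ∞ M]

/-- An almost contact metric structure `(g, ξ, η, φ)` on a smooth `5`-manifold, where
`η = g(ξ, ·)`. -/
structure AlmostContactMetric where
  /-- The Riemannian metric. -/
  g : ContMDiffRiemannianMetric (𝓡 5) ∞ (Euc 5) (fun x : M => TangentSpace (𝓡 5) x)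
  /-- The vector field `ξ`. -/
  ξ : ∀ x : M, TangentSpace (𝓡 5) x
  /-- The endomorphism `φ` of the tangent bundle. -/
  φ : ∀ x : M, TangentSpace (𝓡 5) x →L[ℝ] TangentSpace (𝓡 5) x
  contMDiff_ξ : ContMDiff (𝓡 5) (𝓡 5).tangent ∞ (fun x => (⟨x, ξ x⟩ : TangentBundle (𝓡 5) M))
  contMDiff_φ : ContMDiff (𝓡 5) ((𝓡 5).prod 𝓘(ℝ, Euc 5 →L[ℝ] Euc 5)) ∞
    (fun x => TotalSpace.mk' (Euc 5 →L[ℝ] Euc 5)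
      (E := fun x : M => TangentSpace (𝓡 5) x →L[ℝ] TangentSpace (𝓡 5) x) x (φ x))
  norm_ξ : ∀ x, g.inner x (ξ x) (ξ x) = 1
  φ_ξ : ∀ x, φ x (ξ x) = 0
  φ_φ : ∀ x v, φ x (φ x v) = -v + g.inner x (ξ x) v • ξ x
  g_φ_φ : ∀ x v w, g.inner x (φ x v) (φ x w) =
    g.inner x v w - g.inner x (ξ x) v * g.inner x (ξ x) w

variable {M}

namespace AlmostContactMetric

variable (S : AlmostContactMetric M)

/-- The `1`-form `η` dual to `ξ`. -/
def η (x : M) : TangentSpace (𝓡 5) x →L[ℝ] ℝ := S.g.inner x (S.ξ x)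

/-- The fundamental form `Φ(X, Y) = g(X, φ(Y))`. -/
def Φ (x : M) (v w : TangentSpace (𝓡 5) x) : ℝ := S.g.inner x v (S.φ x w)

/-- Linear forms `e₁, …, e₅` at `x` are an adapted frame (under the identification of tangent
vectors with linear forms by `g`) if they are orthonormal, equivalently `g = ∑ eᵢ ⊗ eᵢ`, and
`Φ = e₁ ∧ e₂ + e₃ ∧ e₄`, `η = e₅`. -/
structure IsAdaptedCoframeAt (x : M) (e : Fin 5 → (TangentSpace (𝓡 5) x →L[ℝ] ℝ)) : Prop where
  metric : ∀ v w, S.g.inner x v w = ∑ i, e i v * e i w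
  fundamental : ∀ v w, S.Φ x v w = wedge (e 0) (e 1) v w + wedge (e 2) (e 3) v w
  contact : S.η x = e 4

/-- Vector fields `e₁, …, e₅` form a smooth adapted frame on the set `U`. -/
structure IsAdaptedFrameOn (e : Fin 5 → ∀ x : M, TangentSpace (𝓡 5) x) (U : Set M) : Prop where
  contMDiffOn : ∀ i, ContMDiffOn (𝓡 5) (𝓡 5).tangent ∞
    (fun x => (⟨x, e i x⟩ : TangentBundle (𝓡 5) M)) U
  adapted : ∀ x ∈ U, S.IsAdaptedCoframeAt x (fun i => S.g.inner x (e i x))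

/-- `∇` is the Levi-Civita connection of the metric: it is metric and torsion-free. -/
structure IsLeviCivita
    (cov : CovariantDerivative (𝓡 5) (Euc 5) (fun x : M => TangentSpace (𝓡 5) x)) : Prop where
  metric : ∀ (Y Z : ∀ x : M, TangentSpace (𝓡 5) x) (x : M) (v : TangentSpace (𝓡 5) x),
    MDifferentiableAt (𝓡 5) (𝓡 5).tangent (fun y => (⟨y, Y y⟩ : TangentBundle (𝓡 5) M)) x →
    MDifferentiableAt (𝓡 5) (𝓡 5).tangent (fun y => (⟨y, Z y⟩ : TangentBundle (𝓡 5) M)) x →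
    mfderiv (𝓡 5) 𝓘(ℝ, ℝ) (fun y => S.g.inner y (Y y) (Z y)) x v =
      S.g.inner x (cov Y x v) (Z x) + S.g.inner x (Y x) (cov Z x v)
  torsion_free : cov.torsion = 0

/-- The matrix `Ω(X) = (ωᵢⱼ(X))`, `ωᵢⱼ(X) = g(∇_X eᵢ, eⱼ)`, of the connection forms with respect
to the frame `e`. -/
def connectionMatrix
    (cov : CovariantDerivative (𝓡 5) (Euc 5) (fun x : M => TangentSpace (𝓡 5) x))
    (e : Fin 5 → ∀ x : M, TangentSpace (𝓡 5) x) (x : M) (v : TangentSpace (𝓡 5) x) : Mat5 :=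
  Matrix.of fun i j => S.g.inner x (cov (e i) x v) (e j x)

/-- The components `Γ(eᵢ)(eⱼ, eₖ)` at `x`, with respect to an adapted frame `e`, of the intrinsic
torsion `Γ(X) = pr_{u(2)^⊥} (Ω(X))`. -/
def intrinsicTorsion
    (cov : CovariantDerivative (𝓡 5) (Euc 5) (fun x : M => TangentSpace (𝓡 5) x))
    (e : Fin 5 → ∀ x : M, TangentSpace (𝓡 5) x) (x : M) : Tensor3 :=
  fun i => prU2Perp (S.connectionMatrix cov e x (e i x))

/-- The almost contact metric manifold is of class `W`, for a `U(2)`-submodule `W` of the space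
of intrinsic torsion tensors: the intrinsic torsion of its Levi-Civita connection, expressed in
adapted local frames, lies in `W` at every point. -/
def IsOfClass (W : Submodule ℝ Tensor3) : Prop :=
  ∃ cov : CovariantDerivative (𝓡 5) (Euc 5) (fun x : M => TangentSpace (𝓡 5) x),
    S.IsLeviCivita cov ∧
    ∀ (U : Set M) (e : Fin 5 → ∀ x : M, TangentSpace (𝓡 5) x), IsOpen U →
      S.IsAdaptedFrameOn e U → ∀ x ∈ U, S.intrinsicTorsion cov e x ∈ W

end AlmostContactMetric

end Manifolds

end AlmostContact

end

/-! The Levi-Civita connection can be written down explicitly. With `f` the pulled-back coframe and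
`A` the pull-back of `A₂`, put `Ω = gaugeMatrix · A + ∑ₖ Tₖ · fₖ`, where `T = θ(β(a₁,a₂)) +
ϑ(β(a₃,a₄))` is `torsionModel` and `β(a,b)` is `betaForm`. This matrix of 1-forms is skew, and the
equations for `de₁,…,de₅` are exactly Cartan's first structure equation for it
(`sum_connectionForm`). Pull-back commutes with `d`, so the equation holds on `M`, and `Ω` is the
connection matrix of the unique Levi-Civita connection (`isLeviCivita_covariant`,
`inner_cov_frame`).

The matrix multiplying `A` lies in `u(2)`, while every `Tₖ` is fixed by the projection onto
`u(2)^⊥`. Hence the intrinsic torsion has the constant components `T` in the given frame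
(`prU2Perp_connectionForm`). In any other adapted frame the inhomogeneous term `dh · hᵀ` of the
gauge transformation is `u(2)`-valued and is projected away, so the components become `h · T` with
`h` in `U(2)`. Since `W4` and `W7` are `U(2)`-invariant, being of class `W` means `T ∈ W`
(`isOfClass_iff`).

What remains is linear algebra. The module `Λ²₂` consists of the forms `β(a,b)`
(`mem_Lambda22_iff_exists`), and `T` determines its four parameters (`torsionModel_injective`), so
`T` lies in `W4` or in `W7` exactly when the other pair of parameters vanishes. -/

noncomputable section

namespace AlmostContact

/-! ### The module `Λ²₂`: explicit basis and characterizations. -/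

/-- The `2`-form `a (e₁ ∧ e₃ - e₂ ∧ e₄) + b (e₁ ∧ e₄ + e₂ ∧ e₃)`. -/
def betaForm (a b : ℝ) : Mat5 :=
  !![0, 0, a, b, 0;
     0, 0, b, -a, 0;
     -a, -b, 0, 0, 0;
     -b, a, 0, 0, 0;
     0, 0, 0, 0, 0]

/-- The coefficients of `betaForm`, with integral parameters. -/
def betaFormInt (a b : ℤ) : Fin 5 → Fin 5 → ℤ :=
  ![![0, 0, a, b, 0], ![0, 0, b, -a, 0], ![-a, -b, 0, 0, 0], ![-b, a, 0, 0, 0], ![0, 0, 0, 0, 0]]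

/-- The relation `∗β = η ∧ β` is linear in `β`, so two basis forms suffice. Their entries are
integers, which turns the identity into a finite decidable check; real coefficients are restored by
linearity in `hodge_betaForm`. -/
theorem sum_epsilon_betaFormInt : ∀ i j k : Fin 5,
    (∑ l, ∑ m, epsilon ![l, m, i, j, k] * betaFormInt 1 0 l m =
      2 * (![0, 0, 0, 0, 1] i * betaFormInt 1 0 j k + ![0, 0, 0, 0, 1] j * betaFormInt 1 0 k i
        + ![0, 0, 0, 0, 1] k * betaFormInt 1 0 i j)) ∧
    (∑ l, ∑ m, epsilon ![l, m, i, j, k] * betaFormInt 0 1 l m =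
      2 * (![0, 0, 0, 0, 1] i * betaFormInt 0 1 j k + ![0, 0, 0, 0, 1] j * betaFormInt 0 1 k i
        + ![0, 0, 0, 0, 1] k * betaFormInt 0 1 i j)) := by
  decide +kernel

theorem betaForm_apply (a b : ℝ) (i j : Fin 5) :
    betaForm a b i j = a * (betaFormInt 1 0 i j : ℝ) + b * (betaFormInt 0 1 i j : ℝ) := by
  fin_cases i <;> fin_cases j <;> simp [betaForm, betaFormInt]

theorem eta0_apply (i : Fin 5) : eta0 i = ((![0, 0, 0, 0, 1] : Fin 5 → ℤ) i : ℝ) := by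
  fin_cases i <;> simp [eta0]

theorem hodge_betaForm (a b : ℝ) : hodge (betaForm a b) = etaWedge (betaForm a b) := by
  funext i j k
  obtain ⟨h1, h2⟩ := sum_epsilon_betaFormInt i j k
  have h1' := congrArg (Int.cast : ℤ → ℝ) h1
  have h2' := congrArg (Int.cast : ℤ → ℝ) h2
  push_cast at h1' h2'
  have : hodge (betaForm a b) i j k =
      (1 / 2) * (a * ∑ l, ∑ m, (epsilon ![l, m, i, j, k] : ℝ) * (betaFormInt 1 0 l m : ℝ)
        + b * ∑ l, ∑ m, (epsilon ![l, m, i, j, k] : ℝ) * (betaFormInt 0 1 l m : ℝ)) := by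
    simp only [hodge, LinearMap.coe_mk, AddHom.coe_mk, betaForm_apply, Finset.mul_sum,
      ← Finset.sum_add_distrib]
    exact Finset.sum_congr rfl fun l _ => Finset.sum_congr rfl fun m _ => by ring
  rw [this, h1', h2']
  simp only [etaWedge, LinearMap.coe_mk, AddHom.coe_mk, betaForm_apply, eta0_apply]
  ring

theorem betaForm_skew (a b : ℝ) : (betaForm a b)ᵀ = -betaForm a b := by
  ext i j
  fin_cases i <;> fin_cases j <;> simp [betaForm]

theorem betaForm_mul_Phi0 (a b : ℝ) : betaForm a b * Phi0 = -(Phi0 * betaForm a b) := by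
  ext i j
  fin_cases i <;> fin_cases j <;> simp [betaForm, Phi0, Matrix.mul_apply, Fin.sum_univ_five]

/-- The integral coefficients of `Φ`. -/
def phiInt : Fin 5 → Fin 5 → ℤ :=
  ![![0, 1, 0, 0, 0], ![-1, 0, 0, 0, 0], ![0, 0, 0, 1, 0], ![0, 0, -1, 0, 0], ![0, 0, 0, 0, 0]]

theorem Phi0_apply (i j : Fin 5) : Phi0 i j = (phiInt i j : ℝ) := by
  fin_cases i <;> fin_cases j <;> simp [Phi0, phiInt]

theorem phiInt_wedge_betaFormInt : ∀ i j k l : Fin 5,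
    (phiInt i j * betaFormInt 1 0 k l - phiInt i k * betaFormInt 1 0 j l
      + phiInt i l * betaFormInt 1 0 j k + phiInt j k * betaFormInt 1 0 i l
      - phiInt j l * betaFormInt 1 0 i k + phiInt k l * betaFormInt 1 0 i j = 0) ∧
    (phiInt i j * betaFormInt 0 1 k l - phiInt i k * betaFormInt 0 1 j l
      + phiInt i l * betaFormInt 0 1 j k + phiInt j k * betaFormInt 0 1 i l
      - phiInt j l * betaFormInt 0 1 i k + phiInt k l * betaFormInt 0 1 i j = 0) := by
  decide +kernel

theorem betaForm_mem_Lambda22 (a b : ℝ) : betaForm a b ∈ Lambda22 := by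
  refine ⟨⟨betaForm_skew a b, ?_⟩, hodge_betaForm a b⟩
  change phiWedge (betaForm a b) = 0
  funext i j k l
  obtain ⟨h1, h2⟩ := phiInt_wedge_betaFormInt i j k l
  have h1' := congrArg (Int.cast : ℤ → ℝ) h1
  have h2' := congrArg (Int.cast : ℤ → ℝ) h2
  push_cast at h1' h2'
  simp only [phiWedge, LinearMap.coe_mk, AddHom.coe_mk, Pi.zero_apply, betaForm_apply, Phi0_apply]
  linear_combination a * h1' + b * h2'

/-- Only the pair of indices complementary to `i, j, k` contributes to the sum. Its two orderings
give equal terms by skewness, cancelling the factor `1 / 2`; the hypothesis on `epsilon` says that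
`(l, m, i, j, k)` is an even permutation. -/
theorem sum_epsilon_mul (β : Mat5) (hβ : βᵀ = -β) (l m i j k : Fin 5)
    (h : ∀ p q, epsilon ![p, q, i, j, k] =
      if p = l ∧ q = m then 1 else if p = m ∧ q = l then -1 else 0) (hlm : l ≠ m) :
    hodge β i j k = β l m := by
  have hs : β m l = -β l m := congrFun (congrFun hβ l) m
  have h2 : ∀ p q : Fin 5, (epsilon ![p, q, i, j, k] : ℝ) * β p q =
      (if p = l then (if q = m then β l m else 0) else 0) +
      (if p = m then (if q = l then β l m else 0) else 0) := by
    intro p q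
    rw [h]
    by_cases h1 : p = l <;> by_cases h2 : q = m <;> by_cases h3 : p = m <;> by_cases h4 : q = l <;>
      simp_all
  simp only [hodge, LinearMap.coe_mk, AddHom.coe_mk, h2, Finset.sum_add_distrib]
  simp
  ring

theorem eq_betaForm_of_skew {β : Mat5} (hβ : βᵀ = -β) (h01 : β 0 1 = 0) (h23 : β 2 3 = 0)
    (h13 : β 1 3 = -β 0 2) (h12 : β 1 2 = β 0 3) (h4 : ∀ i, β i 4 = 0) :
    β = betaForm (β 0 2) (β 0 3) := by
  have hs : ∀ i j, β j i = -β i j := fun i j => congrFun (congrFun hβ i) j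
  have hd : ∀ i, β i i = 0 := fun i => by linarith [hs i i]
  have h4' : ∀ i, β 4 i = 0 := fun i => by rw [hs i 4, h4, neg_zero]
  ext i j
  fin_cases i <;> fin_cases j <;> simp [betaForm, hd, h4, h4', h01, h23, h13, h12]
  · rw [hs 0 1, h01, neg_zero]
  · rw [hs 0 2]
  · rw [hs 1 2, h12]
  · rw [hs 0 3]
  · rw [hs 1 3, h13, neg_neg]
  · rw [hs 2 3, h23, neg_zero]

/-- With indices from `0`, comparing components of `∗β = η ∧ β` gives `β₂₃ = β₀₁`, `β₃₁ = β₀₂`, `β₁₂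
= β₀₃` and kills every entry involving the index `4`. The single component `β₂₃ + β₀₁ = 0` of `Φ ∧ β
= 0` then kills `β₀₁` and `β₂₃`, leaving two parameters. -/
theorem mem_Lambda22_iff_exists {β : Mat5} : β ∈ Lambda22 ↔ ∃ a b, β = betaForm a b := by
  constructor
  · rintro ⟨⟨hs, hk⟩, he⟩
    replace hk : phiWedge β = 0 := hk
    replace he : hodge β = etaWedge β := he
    replace hs : βᵀ = -β := hs
    have hw : ∀ i j k, hodge β i j k = etaWedge β i j k := fun i j k => by rw [he]
    have e01 := hw 0 1 4
    rw [sum_epsilon_mul β hs 2 3 0 1 4 (by decide +kernel) (by decide)] at e01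
    have e02 := hw 0 2 4
    rw [sum_epsilon_mul β hs 3 1 0 2 4 (by decide +kernel) (by decide)] at e02
    have e03 := hw 0 3 4
    rw [sum_epsilon_mul β hs 1 2 0 3 4 (by decide +kernel) (by decide)] at e03
    have e0 := hw 1 2 3
    rw [sum_epsilon_mul β hs 4 0 1 2 3 (by decide +kernel) (by decide)] at e0
    have e1 := hw 0 3 2
    rw [sum_epsilon_mul β hs 4 1 0 3 2 (by decide +kernel) (by decide)] at e1
    have e2 := hw 0 1 3
    rw [sum_epsilon_mul β hs 4 2 0 1 3 (by decide +kernel) (by decide)] at e2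
    have e3 := hw 0 2 1
    rw [sum_epsilon_mul β hs 4 3 0 2 1 (by decide +kernel) (by decide)] at e3
    have e4 : phiWedge β 0 1 2 3 = 0 := by rw [hk]; rfl
    have hs' : ∀ i j, β j i = -β i j := fun i j => congrFun (congrFun hs i) j
    simp [etaWedge, eta0] at e01 e02 e03 e0 e1 e2 e3
    simp [phiWedge, Phi0] at e4
    refine ⟨_, _, eq_betaForm_of_skew hs (by linarith) (by linarith) ?_ (by linarith) ?_⟩
    · linarith [hs' 1 3]
    · intro i
      fin_cases i
      · change β 0 4 = 0; linarith [hs' 0 4]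
      · change β 1 4 = 0; linarith [hs' 1 4]
      · change β 2 4 = 0; linarith [hs' 2 4]
      · change β 3 4 = 0; linarith [hs' 3 4]
      · change β 4 4 = 0; linarith [hs' 4 4]
  · rintro ⟨a, b, rfl⟩
    exact betaForm_mem_Lambda22 a b

/-- Anticommuting with `Φ` is visibly stable under conjugation by matrices commuting with `Φ`, so
this form of the condition yields `U(2)`-invariance without transforming a Hodge star. -/
theorem mem_Lambda22_iff {β : Mat5} :
    β ∈ Lambda22 ↔ βᵀ = -β ∧ β * Phi0 = -(Phi0 * β) := by
  constructor
  · intro h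
    obtain ⟨a, b, rfl⟩ := mem_Lambda22_iff_exists.1 h
    exact ⟨betaForm_skew a b, betaForm_mul_Phi0 a b⟩
  · rintro ⟨hs, hc⟩
    have hs' : ∀ i j, β j i = -β i j := fun i j => congrFun (congrFun hs i) j
    have hc' : ∀ i j, (β * Phi0) i j = -(Phi0 * β) i j := fun i j => by rw [hc]; rfl
    have c00 := hc' 0 0
    have c22 := hc' 2 2
    have c03 := hc' 0 3
    have c02 := hc' 0 2
    have c04 := hc' 0 4
    have c14 := hc' 1 4
    have c24 := hc' 2 4
    have c34 := hc' 3 4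
    simp [Phi0, Matrix.mul_apply, Fin.sum_univ_five] at c00 c22 c03 c02 c04 c14 c24 c34
    rw [mem_Lambda22_iff_exists]
    refine ⟨_, _, eq_betaForm_of_skew hs ?_ ?_ ?_ ?_ ?_⟩
    · linarith [hs' 0 1]
    · linarith [hs' 2 3]
    · linarith
    · linarith
    · intro i
      fin_cases i
      · exact c14.symm
      · exact c04
      · exact c34.symm
      · exact c24
      · have := hs' 4 4; change β 4 4 = 0; linarith

theorem hodge_eq_etaWedge {β : Mat5} (hβ : β ∈ Lambda22) : hodge β = etaWedge β := hβ.2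

/-! ### The action of `U(2)` on tensors and the invariance of `W4` and `W7`. -/

/-- The action of a matrix on covariant `3`-tensors. -/
def act (h : Mat5) (T : Tensor3) : Tensor3 :=
  fun i j k => ∑ l, h i l * (h * Matrix.of (T l) * hᵀ) j k

/-- Elements of `U(2)`, seen as orthogonal matrices preserving `Φ` and `η`. -/
structure IsUnitary2 (h : Mat5) : Prop where
  mul_transpose : h * hᵀ = 1
  comm : h * Phi0 = Phi0 * h
  row : ∀ j, h 4 j = eta0 j

namespace IsUnitary2

variable {h : Mat5}

theorem transpose_comm (hh : IsUnitary2 h) : hᵀ * Phi0 = Phi0 * hᵀ := by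
  have := congrArg Matrix.transpose hh.comm
  rw [Matrix.transpose_mul, Matrix.transpose_mul, phi0_transpose, neg_mul, mul_neg, neg_inj] at this
  exact this.symm

theorem col (hh : IsUnitary2 h) (i : Fin 5) : h i 4 = eta0 i := by
  have := congrFun (congrFun hh.mul_transpose 4) i
  simp only [Matrix.mul_apply, Fin.sum_univ_five, Matrix.transpose_apply, hh.row] at this
  simp [eta0] at this
  rw [this]
  fin_cases i <;> simp [eta0, Matrix.one_apply]

theorem mulVec_eta0 (hh : IsUnitary2 h) : h *ᵥ eta0 = eta0 := by
  funext i
  rw [← hh.col i]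
  simp [Matrix.mulVec, dotProduct, Fin.sum_univ_five, eta0]

theorem conj_mem_Lambda22 (hh : IsUnitary2 h) {β : Mat5} (hβ : β ∈ Lambda22) :
    h * β * hᵀ ∈ Lambda22 := by
  rw [mem_Lambda22_iff] at hβ ⊢
  obtain ⟨h1, h2⟩ := hβ
  constructor
  · rw [Matrix.transpose_mul, Matrix.transpose_mul, h1, Matrix.transpose_transpose]
    noncomm_ring
  · rw [mul_assoc, hh.transpose_comm, ← mul_assoc, mul_assoc h β, h2, mul_neg, neg_mul,
      ← mul_assoc, hh.comm]
    noncomm_ring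

theorem act_etaTensor (hh : IsUnitary2 h) (β : Mat5) :
    act h (etaTensor β) = etaTensor (h * β * hᵀ) := by
  have e : ∀ l, Matrix.of (etaTensor β l) = eta0 l • β := fun l => by
    ext j k; simp [etaTensor]
  funext i j k
  have : ∑ l, h i l * eta0 l = eta0 i := congrFun hh.mulVec_eta0 i
  simp only [act, e, mul_smul_comm, smul_mul_assoc, Matrix.smul_apply, smul_eq_mul, ← mul_assoc,
    ← Finset.sum_mul, this]
  simp [etaTensor]

theorem act_etaWedge (hh : IsUnitary2 h) (β : Mat5) :
    act h (etaWedge β) = etaWedge (h * β * hᵀ) := by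
  -- Each slice of `η ∧ β` is a multiple of `β` plus two rank-one matrices containing `eta0`.
  -- Conjugation by `h` sends `u vᵀ` to `(h u)(h v)ᵀ`, and `h` fixes `eta0`.
  have e : ∀ l, Matrix.of (etaWedge β l) = eta0 l • β + Matrix.vecMulVec eta0 (fun m => β m l)
      + Matrix.vecMulVec (fun m => β l m) eta0 := fun l => by
    ext j k; simp [etaWedge, Matrix.vecMulVec_apply]; ring
  have hc : ∀ u v : Fin 5 → ℝ, h * Matrix.vecMulVec u v * hᵀ
      = Matrix.vecMulVec (h *ᵥ u) (h *ᵥ v) := fun u v => by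
    rw [Matrix.mul_vecMulVec, Matrix.vecMulVec_mul, Matrix.vecMul_transpose]
  have h0 : ∀ i, ∑ l, h i l * eta0 l = eta0 i := congrFun hh.mulVec_eta0
  funext i j k
  have hk : (h * β * hᵀ) k i = ∑ l, h i l * (h *ᵥ (fun m => β m l)) k := by
    simp only [Matrix.mul_apply, Matrix.transpose_apply, Matrix.mulVec, dotProduct]
    exact Finset.sum_congr rfl fun l _ => mul_comm _ _
  have hj : (h * β * hᵀ) i j = ∑ l, h i l * (h *ᵥ (fun m => β l m)) j := by
    rw [mul_assoc]
    simp only [Matrix.mul_apply, Matrix.transpose_apply, Matrix.mulVec, dotProduct]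
    exact Finset.sum_congr rfl fun l _ => by
      congr 1
      exact Finset.sum_congr rfl fun m _ => mul_comm _ _
  simp only [act, e, mul_add, add_mul, hc, hh.mulVec_eta0, mul_smul_comm, smul_mul_assoc,
    Matrix.add_apply, Matrix.smul_apply, Matrix.vecMulVec_apply, smul_eq_mul,
    Finset.sum_add_distrib]
  simp only [etaWedge, LinearMap.coe_mk, AddHom.coe_mk, hk, hj, Finset.mul_sum]
  congr 1
  · congr 1
    · rw [← h0 i, Finset.sum_mul]
      exact Finset.sum_congr rfl fun m _ => by ring
    · exact Finset.sum_congr rfl fun m _ => by ring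
  · exact Finset.sum_congr rfl fun m _ => by ring

end IsUnitary2

theorem act_add (h : Mat5) (S T : Tensor3) : act h (S + T) = act h S + act h T := by
  have : ∀ l, Matrix.of (S l + T l) = Matrix.of (S l) + Matrix.of (T l) := fun l => rfl
  funext i j k
  simp only [act, this, mul_add, add_mul, Matrix.add_apply, Finset.sum_add_distrib, Pi.add_apply]

theorem act_smul (h : Mat5) (c : ℝ) (T : Tensor3) : act h (c • T) = c • act h T := by
  have : ∀ l, Matrix.of (c • T l) = c • Matrix.of (T l) := fun l => rfl
  funext i j k
  simp only [act, this, mul_smul_comm, smul_mul_assoc, Matrix.smul_apply, Pi.smul_apply,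
    smul_eq_mul, mul_left_comm _ c, ← Finset.mul_sum]

/-- Invariance of a space of tensors under `U(2)`. -/
def IsInvariant (W : Submodule ℝ Tensor3) : Prop :=
  ∀ h, IsUnitary2 h → ∀ T ∈ W, act h T ∈ W

/-- On `Λ²₂` the Hodge operator is `η ∧ ·`, so equivariance of the latter is enough; the determinant
of `h` plays no role. -/
theorem isInvariant_W4 : IsInvariant W4 := by
  rintro h hh _ ⟨β, hβ, rfl⟩
  refine ⟨h * β * hᵀ, hh.conj_mem_Lambda22 hβ, ?_⟩
  rw [theta, hodge_eq_etaWedge hβ, hodge_eq_etaWedge (hh.conj_mem_Lambda22 hβ), hh.act_etaWedge]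

theorem vartheta_apply {β : Mat5} (hβ : β ∈ Lambda22) :
    vartheta β = (3 : ℝ) • etaTensor β + (-1 : ℝ) • etaWedge β := by
  rw [← hodge_eq_etaWedge hβ, neg_one_smul, ← sub_eq_add_neg]
  rfl

theorem isInvariant_W7 : IsInvariant W7 := by
  rintro h hh _ ⟨β, hβ, rfl⟩
  refine ⟨h * β * hᵀ, hh.conj_mem_Lambda22 hβ, ?_⟩
  rw [vartheta_apply hβ, vartheta_apply (hh.conj_mem_Lambda22 hβ), act_add, act_smul, act_smul,
    hh.act_etaWedge, hh.act_etaTensor]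

theorem IsInvariant.sup {V W : Submodule ℝ Tensor3} (hV : IsInvariant V) (hW : IsInvariant W) :
    IsInvariant (V ⊔ W) := by
  intro h hh T hT
  obtain ⟨v, hv, w, hw, rfl⟩ := Submodule.mem_sup.1 hT
  rw [act_add]
  exact Submodule.add_mem_sup (hV h hh v hv) (hW h hh w hw)

/-! ### The model torsion tensor and its parameters. -/

/-- The tensor `θ(β(a₁, a₂)) + ϑ(β(a₃, a₄))`. -/
def torsionModel (a₁ a₂ a₃ a₄ : ℝ) : Tensor3 :=
  theta (betaForm a₁ a₂) + vartheta (betaForm a₃ a₄)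

theorem torsionModel_apply (a₁ a₂ a₃ a₄ : ℝ) (i j k : Fin 5) :
    torsionModel a₁ a₂ a₃ a₄ i j k = etaWedge (betaForm a₁ a₂) i j k
      + (3 * (eta0 i * betaForm a₃ a₄ j k) - etaWedge (betaForm a₃ a₄) i j k) := by
  rw [torsionModel, vartheta_apply (betaForm_mem_Lambda22 _ _), theta, hodge_betaForm]
  simp [etaTensor]
  ring

theorem torsionModel_mem_sup (a₁ a₂ a₃ a₄ : ℝ) : torsionModel a₁ a₂ a₃ a₄ ∈ W4 ⊔ W7 :=
  Submodule.add_mem_sup ⟨_, betaForm_mem_Lambda22 _ _, rfl⟩ ⟨_, betaForm_mem_Lambda22 _ _, rfl⟩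

/-- The component `(4,0,2)` is `a₁ + 2a₃` and `(0,2,4)` is `a₁ - a₃`, which together determine `a₁`
and `a₃`; the components `(4,0,3)` and `(0,3,4)` do the same for `a₂` and `a₄`. -/
theorem torsionModel_injective {a₁ a₂ a₃ a₄ b₁ b₂ b₃ b₄ : ℝ}
    (h : torsionModel a₁ a₂ a₃ a₄ = torsionModel b₁ b₂ b₃ b₄) :
    a₁ = b₁ ∧ a₂ = b₂ ∧ a₃ = b₃ ∧ a₄ = b₄ := by
  have h' : ∀ i j k, torsionModel a₁ a₂ a₃ a₄ i j k = torsionModel b₁ b₂ b₃ b₄ i j k :=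
    fun i j k => by rw [h]
  have h1 := h' 4 0 2
  have h2 := h' 4 0 3
  have h3 := h' 0 2 4
  have h4 := h' 0 3 4
  simp only [torsionModel_apply] at h1 h2 h3 h4
  simp [etaWedge, eta0, betaForm] at h1 h2 h3 h4
  refine ⟨?_, ?_, ?_, ?_⟩ <;> linarith

theorem betaForm_zero : betaForm 0 0 = 0 := by
  ext i j; simp [betaForm_apply]

theorem torsionModel_mem_W4_iff (a₁ a₂ a₃ a₄ : ℝ) :
    torsionModel a₁ a₂ a₃ a₄ ∈ W4 ↔ a₃ = 0 ∧ a₄ = 0 := by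
  constructor
  · rintro ⟨β, hβ, h⟩
    obtain ⟨b₁, b₂, rfl⟩ := mem_Lambda22_iff_exists.1 hβ
    have : torsionModel a₁ a₂ a₃ a₄ = torsionModel b₁ b₂ 0 0 := by
      rw [← h, torsionModel, betaForm_zero, map_zero, add_zero]
    exact (torsionModel_injective this).2.2
  · rintro ⟨rfl, rfl⟩
    rw [torsionModel, betaForm_zero, map_zero, add_zero]
    exact ⟨_, betaForm_mem_Lambda22 _ _, rfl⟩

theorem torsionModel_mem_W7_iff (a₁ a₂ a₃ a₄ : ℝ) :
    torsionModel a₁ a₂ a₃ a₄ ∈ W7 ↔ a₁ = 0 ∧ a₂ = 0 := by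
  constructor
  · rintro ⟨β, hβ, h⟩
    obtain ⟨b₃, b₄, rfl⟩ := mem_Lambda22_iff_exists.1 hβ
    have : torsionModel a₁ a₂ a₃ a₄ = torsionModel 0 0 b₃ b₄ := by
      rw [← h, torsionModel, betaForm_zero, map_zero, zero_add]
    obtain ⟨h1, h2, -⟩ := torsionModel_injective this
    exact ⟨h1, h2⟩
  · rintro ⟨rfl, rfl⟩
    rw [torsionModel, betaForm_zero, map_zero, zero_add]
    exact ⟨_, betaForm_mem_Lambda22 _ _, rfl⟩

/-! ### Properties of the projection onto `u(2)^⊥`. -/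

theorem prU2Perp_add (A B : Mat5) : prU2Perp (A + B) = prU2Perp A + prU2Perp B := by
  simp only [prU2Perp, mul_add, add_mul, smul_sub, smul_add]
  abel

theorem prU2Perp_smul (c : ℝ) (A : Mat5) : prU2Perp (c • A) = c • prU2Perp A := by
  simp only [prU2Perp, mul_smul_comm, smul_mul_assoc, ← smul_sub, smul_comm _ c]

theorem prU2Perp_sum {ι : Type*} (s : Finset ι) (A : ι → Mat5) :
    prU2Perp (∑ i ∈ s, A i) = ∑ i ∈ s, prU2Perp (A i) :=
  map_sum ({ toFun := prU2Perp, map_add' := prU2Perp_add, map_smul' := prU2Perp_smul } :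
    Mat5 →ₗ[ℝ] Mat5) A s

/-- On `u(2)` one has `Φ²BΦ² = B` and `ΦBΦ = -B`, so the subtracted term is `½(B + B)`. -/
theorem prU2Perp_eq_zero {B : Mat5} (hB : B ∈ u2) : prU2Perp B = 0 := by
  have h1 := u2_mul_phi0_sq hB
  have h2 : Phi0 * Phi0 * B = -B := by
    rw [mul_assoc, ← hB.2, ← mul_assoc, ← hB.2, mul_assoc, h1]
  have h3 : Phi0 * B * Phi0 = -B := by rw [← hB.2, mul_assoc, h1]
  rw [prU2Perp, h2, h3, neg_mul, h1]
  simp only [neg_neg, sub_neg_eq_add, smul_add, ← add_smul]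
  norm_num

theorem IsUnitary2.prU2Perp_conj {h : Mat5} (hh : IsUnitary2 h) (A : Mat5) :
    prU2Perp (h * A * hᵀ) = h * prU2Perp A * hᵀ := by
  have h1 : ∀ X, Phi0 * (h * X) = h * (Phi0 * X) := fun X => by
    rw [← mul_assoc, ← hh.comm, mul_assoc]
  have h2 : ∀ X, hᵀ * (Phi0 * X) = Phi0 * (hᵀ * X) := fun X => by
    rw [← mul_assoc, hh.transpose_comm, mul_assoc]
  simp only [prU2Perp, mul_sub, sub_mul, mul_smul_comm, smul_mul_assoc, mul_assoc, h1, h2,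
    hh.transpose_comm]

/-! ### Smooth 1-forms, and smoothness of left invariant forms. -/

section SmoothForms

variable {n m : ℕ} {N : Type*} [TopologicalSpace N] [ChartedSpace (Euc n) N]
  {M : Type*} [TopologicalSpace M] [ChartedSpace (Euc m) M]

/-- A `1`-form is smooth if it is smooth as a function on the tangent bundle. -/
def IsSmoothForm (α : ∀ y : N, TangentSpace (𝓡 n) y →L[ℝ] ℝ) [IsManifold (𝓡 n) ∞ N] : Prop :=
  ContMDiff (𝓡 n).tangent 𝓘(ℝ, ℝ) ∞ (fun p : TangentBundle (𝓡 n) N => α p.1 p.2)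

variable [IsManifold (𝓡 n) ∞ N] [IsManifold (𝓡 m) ∞ M]

namespace IsSmoothForm

variable {α : ∀ y : N, TangentSpace (𝓡 n) y →L[ℝ] ℝ}

theorem contMDiffAt_apply (hα : IsSmoothForm α) {X : ∀ y : N, TangentSpace (𝓡 n) y} {x : N}
    (hX : ContMDiffAt (𝓡 n) (𝓡 n).tangent ∞ (fun y => (⟨y, X y⟩ : TangentBundle (𝓡 n) N)) x) :
    ContMDiffAt (𝓡 n) 𝓘(ℝ, ℝ) ∞ (fun y => α y (X y)) x :=
  ContMDiffAt.comp x (g := fun p : TangentBundle (𝓡 n) N => α p.1 p.2)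
    (f := fun y => (⟨y, X y⟩ : TangentBundle (𝓡 n) N)) hα.contMDiffAt hX

theorem mdifferentiableAt_apply (hα : IsSmoothForm α) {X : ∀ y : N, TangentSpace (𝓡 n) y} {x : N}
    (hX : MDifferentiableAt (𝓡 n) (𝓡 n).tangent
      (fun y => (⟨y, X y⟩ : TangentBundle (𝓡 n) N)) x) :
    MDifferentiableAt (𝓡 n) 𝓘(ℝ, ℝ) (fun y => α y (X y)) x :=
  MDifferentiableAt.comp x (g := fun p : TangentBundle (𝓡 n) N => α p.1 p.2)
    (f := fun y => (⟨y, X y⟩ : TangentBundle (𝓡 n) N))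
    (hα.contMDiffAt.mdifferentiableAt (by simp)) hX

theorem pullbackForm (hα : IsSmoothForm α) {f : M → N} (hf : ContMDiff (𝓡 m) (𝓡 n) ∞ f) :
    IsSmoothForm (pullbackForm m n f α) := by
  have h : ContMDiff (𝓡 m).tangent (𝓡 n).tangent ∞ (tangentMap (𝓡 m) (𝓡 n) f) :=
    hf.contMDiff_tangentMap (by simp)
  exact ContMDiff.comp (g := fun p : TangentBundle (𝓡 n) N => α p.1 p.2) hα h

end IsSmoothForm

end SmoothForms

section LieGroups

variable {n : ℕ} {G : Type*} [TopologicalSpace G] [ChartedSpace (Euc n) G] [Group G]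
  [LieGroup (𝓡 n) ∞ G]

/-- Left invariance gives `α_g(v) = α₁(dL_{g⁻¹} v)`, and `(g, v) ↦ dL_{g⁻¹} v` is smooth: it is the
tangent map of multiplication applied to the zero vector at `g⁻¹` paired with `v`. -/
theorem isSmoothForm_of_mem_leftInvariantForms
    {α : ∀ y : G, TangentSpace (𝓡 n) y →L[ℝ] ℝ} (hα : α ∈ leftInvariantForms n G) :
    IsSmoothForm α := by
  let TG := TangentBundle (𝓡 n) G
  let F₁ : TG → TG × TG := fun p => (TotalSpace.mk' (Euc n) p.1⁻¹ 0, p)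
  have S₁ : ContMDiff (𝓡 n).tangent ((𝓡 n).tangent.prod (𝓡 n).tangent) ∞ F₁ := by
    refine ContMDiff.prodMk ?_ contMDiff_id
    exact (contMDiff_zeroSection ℝ (TangentSpace (𝓡 n) : G → Type _)).comp
      ((contMDiff_inv (𝓡 n) ∞).comp (contMDiff_proj (TangentSpace (𝓡 n))))
  let F₂ : TG × TG → TangentBundle ((𝓡 n).prod (𝓡 n)) (G × G) :=
    (equivTangentBundleProd (𝓡 n) G (𝓡 n) G).symm
  have S₂ : ContMDiff ((𝓡 n).tangent.prod (𝓡 n).tangent) ((𝓡 n).prod (𝓡 n)).tangent ∞ F₂ :=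
    contMDiff_equivTangentBundleProd_symm
  let F₃ : TangentBundle ((𝓡 n).prod (𝓡 n)) (G × G) → TG :=
    tangentMap ((𝓡 n).prod (𝓡 n)) (𝓡 n) (fun p : G × G => p.1 * p.2)
  have S₃ : ContMDiff ((𝓡 n).prod (𝓡 n)).tangent (𝓡 n).tangent ∞ F₃ :=
    (contMDiff_mul (𝓡 n) ∞).contMDiff_tangentMap (by simp)
  have S := (S₃.comp S₂).comp S₁
  have hproj : ∀ p, (F₃ (F₂ (F₁ p))).1 = 1 := fun p => inv_mul_cancel p.1
  have hval : ∀ p : TG, α (F₃ (F₂ (F₁ p))).1 (F₃ (F₂ (F₁ p))).2 = α p.1 p.2 := by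
    intro p
    have h := DFunLike.congr_fun (hα p.1⁻¹ p.1) p.2
    refine Eq.trans ?_ h
    simp only [F₃, F₂, F₁, tangentMap]
    rw [mfderiv_prod_eq_add_apply ((contMDiff_mul (𝓡 n) ∞).mdifferentiableAt (by simp))]
    simp +instances
    exact congrArg (α _) ((congrArg (· + _) (map_zero _)).trans (zero_add _))
  -- All the translated vectors lie over `1`, where the trivialization at `1` is the identity on the
  -- fibre. The form is thus one fixed linear functional of the fibre coordinate, which depends
  -- smoothly on the point.
  have htriv : ∀ q : TG, q.1 = 1 →
      α q.1 q.2 = α 1 ((trivializationAt (Euc n) (TangentSpace (𝓡 n)) (1 : G) q).2) := by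
    rintro ⟨g, v⟩ rfl
    have h1 := TangentBundle.continuousLinearMapAt_trivializationAt (I := 𝓡 n) (x₀ := (1 : G)) (x := 1)
      (mem_chart_source _ _)
    rw [mfderiv_extChartAt_self] at h1
    have h2 := DFunLike.congr_fun h1 v
    rw [Trivialization.continuousLinearMapAt_apply, Trivialization.linearMapAt_apply] at h2
    rw [if_pos (FiberBundle.mem_baseSet_trivializationAt' _)] at h2
    exact (congrArg (α 1) h2).symm
  intro p
  have h2 := (contMDiffAt_totalSpace.1 (S.contMDiffAt (x := p))).2
  have h3 : ((F₃ ∘ F₂) ∘ F₁) p = F₃ (F₂ (F₁ p)) := rfl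
  rw [h3, hproj p] at h2
  have h4 := ((α 1).contMDiff (n := ∞)).contMDiffAt.comp p h2
  refine h4.congr_of_eventuallyEq (Filter.Eventually.of_forall fun q => ?_)
  exact (hval q).symm.trans (htriv _ (hproj q))

end LieGroups

/-! ### The exterior derivative: naturality and the Cartan formula. -/

section ExteriorDerivative

open VectorField Filter
open scoped Topology

variable {n m : ℕ} {N : Type*} [TopologicalSpace N] [ChartedSpace (Euc n) N]
  {M : Type*} [TopologicalSpace M] [ChartedSpace (Euc m) M]
  {α : ∀ y : N, TangentSpace (𝓡 n) y →L[ℝ] ℝ}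

theorem extDeriv_apply_two {E : Type*} [NormedAddCommGroup E] [NormedSpace ℝ E]
    {τ : E → E [⋀^Fin 1]→L[ℝ] ℝ} {V W : E → E} {x : E} (hτ : DifferentiableAt ℝ τ x)
    (hV : DifferentiableAt ℝ V x) (hW : DifferentiableAt ℝ W x) :
    extDeriv τ x ![V x, W x] = fderiv ℝ (fun y => τ y ![W y]) x (V x)
      - fderiv ℝ (fun y => τ y ![V y]) x (W x) - τ x ![lieBracket ℝ V W x] := by
  have h := extDeriv_apply_vectorField (V := ![V, W]) hτ (by
    intro i
    fin_cases i
    exacts [hV, hW])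
  have e : (fun i => (![V, W] : Fin 2 → E → E) i x) = ![V x, W x] := by
    funext i; fin_cases i <;> rfl
  have e0 : ∀ y, (0 : Fin 2).removeNth (fun i => (![V, W] : Fin 2 → E → E) i y) = ![W y] := by
    intro y; funext i; fin_cases i; rfl
  have e1 : ∀ y, (1 : Fin 2).removeNth (fun i => (![V, W] : Fin 2 → E → E) i y) = ![V y] := by
    intro y; funext i; fin_cases i; rfl
  have e2 : ∀ (v : E) (u : Fin 0 → E), (Matrix.vecCons v u : Fin 1 → E) = ![v] := by
    intro v u; funext i; fin_cases i; rfl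
  have e3 : ∀ j : Fin 1, j = 0 := fun j => Subsingleton.elim _ _
  rw [e, Fin.sum_univ_two, Fin.sum_univ_one] at h
  simp only [e0, e1, e2] at h
  rw [h]
  simp
  ring

/-- All tangent spaces unfold to `Euc n`, so the same vector can be fed to `α` at propositionally
equal base points without a cast. -/
theorem form_apply_congr (α : ∀ y : N, TangentSpace (𝓡 n) y →L[ℝ] ℝ) {y z : N} (h : y = z)
    (v : Euc n) : (show Euc n →L[ℝ] ℝ from α y) v = (show Euc n →L[ℝ] ℝ from α z) v := by
  subst h; rfl

theorem formInChart_apply (α : ∀ y : N, TangentSpace (𝓡 n) y →L[ℝ] ℝ) (x : N) (u : Euc n)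
    (w : Fin 1 → Euc n) : formInChart α x u w = α ((extChartAt (𝓡 n) x).symm u)
      (mfderiv 𝓘(ℝ, Euc n) (𝓡 n) (extChartAt (𝓡 n) x).symm u (w 0)) :=
  rfl

theorem extChartAt_target_mem_nhds' (x : N) :
    (extChartAt (𝓡 n) x).target ∈ 𝓝 (extChartAt (𝓡 n) x x) :=
  (isOpen_extChartAt_target x).mem_nhds (mem_extChartAt_target x)

theorem mvfderiv_eq_fderiv {f : N → ℝ} {x : N} (hf : MDifferentiableAt (𝓡 n) 𝓘(ℝ, ℝ) f x)
    (v : TangentSpace (𝓡 n) x) : mvfderiv (𝓡 n) f x v =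
      fderiv ℝ (fun u => f ((extChartAt (𝓡 n) x).symm u)) (extChartAt (𝓡 n) x x) v := by
  rw [hf.mvfderiv]
  simp only [writtenInExtChartAt, ModelWithCorners.range_eq_univ, fderivWithin_univ]
  rfl

theorem mfderiv_eq_fderiv_writtenInExtChartAt {f : M → N} {x : M}
    (hf : MDifferentiableAt (𝓡 m) (𝓡 n) f x) :
    mfderiv (𝓡 m) (𝓡 n) f x =
      fderiv ℝ (writtenInExtChartAt (𝓡 m) (𝓡 n) x f) (extChartAt (𝓡 m) x x) := by
  rw [hf.mfderiv, ModelWithCorners.range_eq_univ, fderivWithin_univ]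

variable [IsManifold (𝓡 n) ∞ N] [IsManifold (𝓡 m) ∞ M]

theorem IsSmoothForm.contDiffOn_formInChart (hα : IsSmoothForm α) (x : N) :
    ContDiffOn ℝ ∞ (formInChart α x) (extChartAt (𝓡 n) x).target := by
  have ho := isOpen_extChartAt_target (I := 𝓡 n) x
  have key : ContDiffOn ℝ ∞ (fun u : Euc n => (show Euc n →L[ℝ] ℝ from
      (α ((extChartAt (𝓡 n) x).symm u)).comp
        (mfderiv 𝓘(ℝ, Euc n) (𝓡 n) (extChartAt (𝓡 n) x).symm u))) (extChartAt (𝓡 n) x).target := by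
    -- In finite dimension, smoothness of a map into linear functionals can be tested on fixed
    -- vectors. On a constant field the value is `α` composed with the tangent map of the inverse
    -- chart.
    rw [contDiffOn_clm_apply]
    intro v
    rw [← contMDiffOn_iff_contDiffOn]
    have h1 : ContMDiffOn 𝓘(ℝ, Euc n).tangent (𝓡 n).tangent ∞
        (tangentMapWithin 𝓘(ℝ, Euc n) (𝓡 n) (extChartAt (𝓡 n) x).symm (extChartAt (𝓡 n) x).target)
        (π (Euc n) (TangentSpace 𝓘(ℝ, Euc n)) ⁻¹' (extChartAt (𝓡 n) x).target) :=
      (contMDiffOn_extChartAt_symm (n := ∞) x).contMDiffOn_tangentMapWithin (by simp)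
        ho.uniqueMDiffOn
    have h2 : ContMDiff 𝓘(ℝ, Euc n) 𝓘(ℝ, Euc n).tangent ∞
        (fun u => (⟨u, v⟩ : TangentBundle 𝓘(ℝ, Euc n) (Euc n))) :=
      contMDiff_vectorSpace_iff_contDiff.2 contDiff_const
    have h3 := hα.comp_contMDiffOn (h1.comp h2.contMDiffOn (s := (extChartAt (𝓡 n) x).target)
      (fun u hu => hu))
    refine h3.congr fun u hu => ?_
    simp only [Function.comp_apply, tangentMapWithin, mfderivWithin_of_isOpen ho hu]
    rfl
  exact (ContinuousAlternatingMap.ofSubsingletonLIE (𝕜 := ℝ) (E := Euc n) (F := ℝ)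
    (0 : Fin 1)).toContinuousLinearEquiv.contDiff.comp_contDiffOn key

theorem IsSmoothForm.differentiableAt_formInChart (hα : IsSmoothForm α) (x : N) {u : Euc n}
    (hu : u ∈ (extChartAt (𝓡 n) x).target) : DifferentiableAt ℝ (formInChart α x) u :=
  ((hα.contDiffOn_formInChart x).differentiableOn (by simp)).differentiableAt
    ((isOpen_extChartAt_target x).mem_nhds hu)

theorem extDerivOne_eq (α : ∀ y : N, TangentSpace (𝓡 n) y →L[ℝ] ℝ) (x : N)
    (v w : TangentSpace (𝓡 n) x) :
    extDerivOne α x v w = extDeriv (formInChart α x) (extChartAt (𝓡 n) x x)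
      (![v, w] : Fin 2 → Euc n) := by
  rw [extDerivOne, mfderiv_extChartAt_self]
  rfl

/-- Near the base point `f ∘ φ⁻¹ = ψ⁻¹ ∘ F`, where `φ`, `ψ` are the charts and `F` is `f` written in
them; differentiating both sides by the chain rule compares the two forms. This reduces naturality
of `d` to the vector space case. -/
theorem formInChart_pullbackForm_eventuallyEq {f : M → N} (hf : ContMDiff (𝓡 m) (𝓡 n) ∞ f)
    (x : M) :
    formInChart (pullbackForm m n f α) x =ᶠ[𝓝 (extChartAt (𝓡 m) x x)] fun u =>
      (formInChart α (f x) (writtenInExtChartAt (𝓡 m) (𝓡 n) x f u)).compContinuousLinearMap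
        (fderiv ℝ (writtenInExtChartAt (𝓡 m) (𝓡 n) x f) u) := by
  set F := writtenInExtChartAt (𝓡 m) (𝓡 n) x f with hF
  have hsrc : ∀ᶠ u in 𝓝 (extChartAt (𝓡 m) x x), u ∈ (extChartAt (𝓡 m) x).target ∧
      f ((extChartAt (𝓡 m) x).symm u) ∈ (extChartAt (𝓡 n) (f x)).source := by
    refine Filter.Eventually.and (extChartAt_target_mem_nhds' x) ?_
    have hc : ContinuousAt (fun u => f ((extChartAt (𝓡 m) x).symm u)) (extChartAt (𝓡 m) x x) := by
      refine ContinuousAt.comp ?_ (continuousAt_extChartAt_symm x)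
      exact hf.continuous.continuousAt
    refine hc.eventually_mem ?_
    rw [extChartAt_to_inv]
    exact extChartAt_source_mem_nhds _
  filter_upwards [hsrc.eventually_nhds] with u hu
  obtain ⟨hu1, hu2⟩ := hu.self_of_nhds
  have hs1 : MDifferentiableAt 𝓘(ℝ, Euc m) (𝓡 m) (extChartAt (𝓡 m) x).symm u := by
    have := mdifferentiableWithinAt_extChartAt_symm (I := 𝓡 m) hu1
    rwa [ModelWithCorners.range_eq_univ, mdifferentiableWithinAt_univ] at this
  have hFt : F u ∈ (extChartAt (𝓡 n) (f x)).target := (extChartAt (𝓡 n) (f x)).map_source hu2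
  have hs2 : MDifferentiableAt 𝓘(ℝ, Euc n) (𝓡 n) (extChartAt (𝓡 n) (f x)).symm (F u) := by
    have := mdifferentiableWithinAt_extChartAt_symm (I := 𝓡 n) hFt
    rwa [ModelWithCorners.range_eq_univ, mdifferentiableWithinAt_univ] at this
  have hfu : MDifferentiableAt (𝓡 m) (𝓡 n) f ((extChartAt (𝓡 m) x).symm u) :=
    hf.mdifferentiable (by simp) _
  have hψ : MDifferentiableAt (𝓡 n) 𝓘(ℝ, Euc n) (extChartAt (𝓡 n) (f x))
      (f ((extChartAt (𝓡 m) x).symm u)) :=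
    mdifferentiableAt_extChartAt (by rwa [extChartAt_source] at hu2)
  have hFd : MDifferentiableAt 𝓘(ℝ, Euc m) 𝓘(ℝ, Euc n) F u := hψ.comp u (hfu.comp u hs1)
  have hb : (extChartAt (𝓡 n) (f x)).symm (F u) = f ((extChartAt (𝓡 m) x).symm u) :=
    (extChartAt (𝓡 n) (f x)).left_inv hu2
  have heq : (f ∘ (extChartAt (𝓡 m) x).symm) =ᶠ[𝓝 u] ((extChartAt (𝓡 n) (f x)).symm ∘ F) := by
    filter_upwards [hu] with z hz
    exact ((extChartAt (𝓡 n) (f x)).left_inv hz.2).symm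
  have hd : mfderiv 𝓘(ℝ, Euc m) (𝓡 n) (f ∘ (extChartAt (𝓡 m) x).symm) u =
      mfderiv 𝓘(ℝ, Euc m) (𝓡 n) ((extChartAt (𝓡 n) (f x)).symm ∘ F) u := heq.mfderiv_eq
  rw [mfderiv_comp u hfu hs1, mfderiv_comp u hs2 hFd, mfderiv_eq_fderiv] at hd
  ext w
  have hv := DFunLike.congr_fun hd (w 0)
  rw [ContinuousAlternatingMap.compContinuousLinearMap_apply, formInChart_apply, formInChart_apply]
  refine Eq.trans ?_ (form_apply_congr α hb.symm _)
  exact congrArg (show Euc n →L[ℝ] ℝ from α (f ((extChartAt (𝓡 m) x).symm u))) hv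

/-- The exterior derivative commutes with pull-backs. -/
theorem extDerivOne_pullbackForm (hα : IsSmoothForm α) {f : M → N}
    (hf : ContMDiff (𝓡 m) (𝓡 n) ∞ f) (x : M) (v w : TangentSpace (𝓡 m) x) :
    extDerivOne (pullbackForm m n f α) x v w =
      extDerivOne α (f x) (mfderiv (𝓡 m) (𝓡 n) f x v) (mfderiv (𝓡 m) (𝓡 n) f x w) := by
  have hF : writtenInExtChartAt (𝓡 m) (𝓡 n) x f (extChartAt (𝓡 m) x x) =
      extChartAt (𝓡 n) (f x) (f x) := by
    simp [writtenInExtChartAt]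
  have hFd : ContDiffAt ℝ ∞ (writtenInExtChartAt (𝓡 m) (𝓡 n) x f) (extChartAt (𝓡 m) x x) := by
    have := (contMDiffAt_iff.1 (hf.contMDiffAt (x := x))).2
    rwa [ModelWithCorners.range_eq_univ, contDiffWithinAt_univ] at this
  rw [extDerivOne_eq, extDerivOne_eq,
    (formInChart_pullbackForm_eventuallyEq hf x).extDeriv_eq,
    extDeriv_pullback (r := ∞) (by
      rw [hF]; exact hα.differentiableAt_formInChart _ (mem_extChartAt_target _)) hFd
      (by simpa using ENat.LEInfty.out), hF,
    mfderiv_eq_fderiv_writtenInExtChartAt (hf.mdifferentiable (by simp) x)]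
  rw [ContinuousAlternatingMap.compContinuousLinearMap_apply]
  congr 1
  funext i
  fin_cases i <;> rfl

/-- The Cartan formula for the exterior derivative of a `1`-form. -/
theorem extDerivOne_apply_vectorField (hα : IsSmoothForm α)
    {X Y : ∀ y : N, TangentSpace (𝓡 n) y} {x : N}
    (hX : MDifferentiableAt (𝓡 n) (𝓡 n).tangent (fun y => (⟨y, X y⟩ : TangentBundle (𝓡 n) N)) x)
    (hY : MDifferentiableAt (𝓡 n) (𝓡 n).tangent (fun y => (⟨y, Y y⟩ : TangentBundle (𝓡 n) N)) x) :
    extDerivOne α x (X x) (Y x) =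
      mvfderiv (𝓡 n) (fun y => α y (Y y)) x (X x) - mvfderiv (𝓡 n) (fun y => α y (X y)) x (Y x)
        - α x (mlieBracket (𝓡 n) X Y x) := by
  have : IsManifold (𝓡 n) 2 N := IsManifold.of_le (n := ∞) ENat.LEInfty.out
  -- The fields are pulled back through the inverse chart. This is how the manifold Lie bracket is
  -- defined, and pairing `formInChart` with such a field gives the function `α(Z)` read in the
  -- chart, so the formula in `Euc n` transfers term by term.
  let P : (∀ y : N, TangentSpace (𝓡 n) y) → Euc n → Euc n := fun Z =>
    mpullbackWithin 𝓘(ℝ, Euc n) (𝓡 n) (extChartAt (𝓡 n) x).symm Z (Set.range (𝓡 n))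
  have hPd : ∀ Z : (∀ y : N, TangentSpace (𝓡 n) y), MDifferentiableAt (𝓡 n) (𝓡 n).tangent
      (fun y => (⟨y, Z y⟩ : TangentBundle (𝓡 n) N)) x →
      DifferentiableAt ℝ (P Z) (extChartAt (𝓡 n) x x) := by
    intro Z hZ
    have := (mdifferentiableWithinAt_univ.2
      hZ).differentiableWithinAt_mpullbackWithin_vectorField
    rw [Set.preimage_univ, Set.univ_inter] at this
    nth_rewrite 2 [ModelWithCorners.range_eq_univ] at this
    exact differentiableWithinAt_univ.1 this
  have hP0 : ∀ Z, P Z (extChartAt (𝓡 n) x x) = Z x := by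
    intro Z
    have h0 : (extChartAt (𝓡 n) x).symm (extChartAt (𝓡 n) x x) = x := extChartAt_to_inv x
    have h1 : ∀ y, y = x → (show Euc n from Z y) = Z x := by rintro y rfl; rfl
    refine Eq.trans ?_ (h1 _ h0)
    exact mfderivWithin_extChartAt_symm_inverse_apply (I := 𝓡 n) (x := x) _
  have hform : ∀ Z, (fun u => formInChart α x u ![P Z u]) =ᶠ[𝓝 (extChartAt (𝓡 n) x x)]
      fun u => α ((extChartAt (𝓡 n) x).symm u) (Z ((extChartAt (𝓡 n) x).symm u)) := by
    intro Z
    filter_upwards [extChartAt_target_mem_nhds' x] with u hu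
    rw [formInChart_apply]
    have hinv := isInvertible_mfderivWithin_extChartAt_symm (I := 𝓡 n) hu
    have h1 : mfderiv 𝓘(ℝ, Euc n) (𝓡 n) (extChartAt (𝓡 n) x).symm u =
        mfderivWithin 𝓘(ℝ, Euc n) (𝓡 n) (extChartAt (𝓡 n) x).symm (Set.range (𝓡 n)) u := by
      rw [ModelWithCorners.range_eq_univ, mfderivWithin_univ]
    rw [h1]
    exact congrArg (α _) (hinv.self_apply_inverse _)
  have hα' := hα.differentiableAt_formInChart x (mem_extChartAt_target (I := 𝓡 n) x)
  have hα0 : ∀ w : Euc n, formInChart α x (extChartAt (𝓡 n) x x) ![w] = α x w := by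
    intro w
    rw [formInChart_apply]
    have h0 := mfderivWithin_range_extChartAt_symm (I := 𝓡 n) (x := x)
    rw [ModelWithCorners.range_eq_univ, mfderivWithin_univ] at h0
    exact (congrArg (α _) (DFunLike.congr_fun h0 w)).trans
      (form_apply_congr α (extChartAt_to_inv x) w)
  have hbr : mlieBracket (𝓡 n) X Y x =
      lieBracket ℝ (P X) (P Y) (extChartAt (𝓡 n) x x) := by
    rw [mlieBracket, mlieBracketWithin_apply, mfderiv_extChartAt_self, Set.preimage_univ,
      Set.univ_inter]
    have h1 : Set.range (𝓡 n) = Set.univ := ModelWithCorners.range_eq_univ _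
    have h2 : (ContinuousLinearMap.id ℝ (Euc n)).inverse = ContinuousLinearMap.id ℝ (Euc n) :=
      ContinuousLinearMap.inverse_id
    refine (DFunLike.congr_fun h2 _).trans ?_
    change lieBracketWithin ℝ (P X) (P Y) (Set.range (𝓡 n)) (extChartAt (𝓡 n) x x) = _
    rw [h1, lieBracketWithin_univ]
  have hX' : MDifferentiableAt (𝓡 n) 𝓘(ℝ, ℝ) (fun y => α y (X y)) x :=
    hα.mdifferentiableAt_apply hX
  have hY' : MDifferentiableAt (𝓡 n) 𝓘(ℝ, ℝ) (fun y => α y (Y y)) x :=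
    hα.mdifferentiableAt_apply hY
  rw [extDerivOne_eq, mvfderiv_eq_fderiv hX', mvfderiv_eq_fderiv hY', hbr,
    ← (hform X).fderiv_eq, ← (hform Y).fderiv_eq]
  have hmain := extDeriv_apply_two hα' (hPd X hX) (hPd Y hY)
  rw [hP0 X, hP0 Y, hα0] at hmain
  exact hmain

end ExteriorDerivative

/-! ### Adapted coframes and their dual frames. -/

namespace AlmostContactMetric

open scoped Topology
open VectorField

variable {M : Type*} [TopologicalSpace M] [ChartedSpace (Euc 5) M] [IsManifold (𝓡 5) ∞ M]
  {S : AlmostContactMetric M}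

section PointwiseCoframe

variable {x : M} {e : Fin 5 → (TangentSpace (𝓡 5) x →L[ℝ] ℝ)}

theorem IsAdaptedCoframeAt.eq_zero (he : S.IsAdaptedCoframeAt x e) {v : TangentSpace (𝓡 5) x}
    (hv : ∀ i, e i v = 0) : v = 0 := by
  by_contra hne
  have h1 := S.g.pos x v hne
  rw [he.metric] at h1
  simp [hv] at h1

theorem IsAdaptedCoframeAt.ext (he : S.IsAdaptedCoframeAt x e) {v w : TangentSpace (𝓡 5) x}
    (hv : ∀ i, e i v = e i w) : v = w :=
  sub_eq_zero.1 (he.eq_zero fun i => by rw [map_sub, hv, sub_self])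

/-- Positivity of the metric makes `v ↦ (eᵢ v)` injective, hence bijective by dimension. -/
theorem IsAdaptedCoframeAt.exists_dual (he : S.IsAdaptedCoframeAt x e) :
    ∃ E : Fin 5 → TangentSpace (𝓡 5) x, ∀ i j, e i (E j) = if i = j then 1 else 0 := by
  let L : Euc 5 →ₗ[ℝ] (Fin 5 → ℝ) :=
    LinearMap.pi fun i => (show Euc 5 →L[ℝ] ℝ from e i).toLinearMap
  have hL : Function.Injective L := by
    rw [injective_iff_map_eq_zero]
    exact fun v hv => he.eq_zero fun i => congrFun hv i
  have hs : Function.Surjective L :=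
    (LinearMap.injective_iff_surjective_of_finrank_eq_finrank (by simp)).1 hL
  choose E hE using fun j : Fin 5 => hs (Pi.single j 1)
  refine ⟨E, fun i j => ?_⟩
  have h := congrFun (hE j) i
  rw [Pi.single_apply] at h
  exact h

end PointwiseCoframe

/-- A smooth global adapted coframe `f` with its dual frame `E`. -/
structure IsGlobalFrame (S : AlmostContactMetric M)
    (f : Fin 5 → ∀ x : M, TangentSpace (𝓡 5) x →L[ℝ] ℝ)
    (E : Fin 5 → ∀ x : M, TangentSpace (𝓡 5) x) : Prop where
  smooth : ∀ i, IsSmoothForm (f i)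
  adapted : ∀ x, S.IsAdaptedCoframeAt x (fun i => f i x)
  dual : ∀ x i j, f i x (E j x) = if i = j then 1 else 0

theorem exists_isGlobalFrame {f : Fin 5 → ∀ x : M, TangentSpace (𝓡 5) x →L[ℝ] ℝ}
    (hf : ∀ i, IsSmoothForm (f i)) (hS : ∀ x, S.IsAdaptedCoframeAt x (fun i => f i x)) :
    ∃ E, IsGlobalFrame S f E := by
  choose E hE using fun x => (hS x).exists_dual
  exact ⟨fun i x => E x i, hf, hS, hE⟩

namespace IsGlobalFrame

variable {f : Fin 5 → ∀ x : M, TangentSpace (𝓡 5) x →L[ℝ] ℝ}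
  {E : Fin 5 → ∀ x : M, TangentSpace (𝓡 5) x}

theorem inner_frame (h : IsGlobalFrame S f E) (x : M) (v : TangentSpace (𝓡 5) x)
    (k : Fin 5) :
    S.g.inner x v (E k x) = f k x v := by
  rw [(h.adapted x).metric]
  simp [h.dual]

theorem eq_sum (h : IsGlobalFrame S f E) (x : M) (v : TangentSpace (𝓡 5) x) :
    v = ∑ i, f i x v • E i x :=
  (h.adapted x).ext fun i => by simp [map_sum, h.dual]

/-- The dual frame is chosen point by point, so its smoothness needs proof. In a smooth local frame
`s` the matrix `fᵢ(sₖ)` is smooth and invertible, and the coordinates of `E j` are the `j`-th column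
of its inverse; inversion is smooth. -/
theorem contMDiff_frame (h : IsGlobalFrame S f E) (j : Fin 5) :
    ContMDiff (𝓡 5) (𝓡 5).tangent ∞ (fun x => (⟨x, E j x⟩ : TangentBundle (𝓡 5) M)) := by
  intro x₀
  let t := trivializationAt (Euc 5) (TangentSpace (𝓡 5) : M → Type _) x₀
  let b : Module.Basis (Fin 5) ℝ (Euc 5) := (EuclideanSpace.basisFun (Fin 5) ℝ).toBasis
  let s : Fin 5 → ∀ y : M, TangentSpace (𝓡 5) y := t.localFrame b
  have hx₀ : x₀ ∈ t.baseSet := FiberBundle.mem_baseSet_trivializationAt' _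
  have hs : ∀ k, ContMDiffAt (𝓡 5) (𝓡 5).tangent ∞
      (fun y => (⟨y, s k y⟩ : TangentBundle (𝓡 5) M)) x₀ := fun k =>
    contMDiffAt_localFrame_of_mem ∞ t b k hx₀
  have hli : ∀ y ∈ t.baseSet, LinearIndependent ℝ (fun k => s k y) := fun y hy =>
    (t.isLocalFrameOn_localFrame_baseSet (𝓡 5) ∞ b).linearIndependent hy
  let C : Fin 5 → Fin 5 → ((Fin 5 → ℝ) →L[ℝ] (Fin 5 → ℝ)) := fun i k =>
    (ContinuousLinearMap.proj (R := ℝ) (φ := fun _ : Fin 5 => ℝ) k).smulRight (Pi.single i 1)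
  let F : M → ((Fin 5 → ℝ) →L[ℝ] (Fin 5 → ℝ)) := fun y => ∑ i, ∑ k, f i y (s k y) • C i k
  have hF : ContMDiffAt (𝓡 5) 𝓘(ℝ, (Fin 5 → ℝ) →L[ℝ] (Fin 5 → ℝ)) ∞ F x₀ := by
    refine contMDiffAt_finsetSum fun i _ => contMDiffAt_finsetSum fun k _ => ?_
    exact ((h.smooth i).contMDiffAt_apply (hs k)).smul contMDiffAt_const
  have hFapply : ∀ y u i, F y u i = f i y (∑ k, u k • s k y) := by
    intro y u i
    simp only [F, C, sum_apply, smul_apply,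
      ContinuousLinearMap.smulRight_apply, ContinuousLinearMap.proj_apply, Finset.sum_apply,
      Pi.smul_apply, smul_eq_mul, Pi.single_apply, map_sum, map_smul]
    rw [Finset.sum_eq_single i]
    · simp [mul_comm]
    · intro j _ hj
      simp [hj.symm]
    · simp
  have hinv : ∀ y ∈ t.baseSet, (F y).IsInvertible := by
    intro y hy
    have hinj : Function.Injective (F y).toLinearMap := by
      rw [injective_iff_map_eq_zero]
      intro u hu
      have h0 : ∑ k, u k • s k y = 0 := (h.adapted y).eq_zero fun i => by
        rw [← hFapply]
        exact congrFun hu i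
      exact funext (Fintype.linearIndependent_iff.1 (hli y hy) u h0)
    exact ⟨(LinearEquiv.ofInjectiveEndo _ hinj).toContinuousLinearEquiv, by ext; rfl⟩
  have hFi : ContMDiffAt (𝓡 5) 𝓘(ℝ, (Fin 5 → ℝ) →L[ℝ] (Fin 5 → ℝ)) ∞
      (fun y => (F y).inverse) x₀ := by
    obtain ⟨e, he⟩ := hinv x₀ hx₀
    have h1 : ContDiffAt ℝ ∞ ContinuousLinearMap.inverse (F x₀) := by
      rw [← he]
      exact contDiffAt_map_inverse e
    exact h1.contMDiffAt.comp x₀ hF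
  have hc : ∀ k, ContMDiffAt (𝓡 5) 𝓘(ℝ, ℝ) ∞ (fun y => (F y).inverse (Pi.single j 1) k) x₀ := by
    intro k
    have h1 : ContMDiffAt (𝓡 5) 𝓘(ℝ, Fin 5 → ℝ) ∞ (fun y => (F y).inverse (Pi.single j 1)) x₀ :=
      hFi.clm_apply contMDiffAt_const
    exact contMDiffAt_pi_space.1 h1 k
  have hsum := ContMDiffAt.sum_section (s := Finset.univ) fun k _ => (hc k).smul_section (hs k)
  refine hsum.congr_of_eventuallyEq ?_
  filter_upwards [t.open_baseSet.mem_nhds hx₀] with y hy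
  have hE : E j y = ∑ k, (F y).inverse (Pi.single j 1) k • s k y := (h.adapted y).ext fun i => by
    rw [← hFapply, (hinv y hy).self_apply_inverse, h.dual, Pi.single_apply]
  simp [hE]

theorem mdifferentiableAt_frame (h : IsGlobalFrame S f E) (j : Fin 5) (x : M) :
    MDifferentiableAt (𝓡 5) (𝓡 5).tangent (fun y => (⟨y, E j y⟩ : TangentBundle (𝓡 5) M)) x :=
  (h.contMDiff_frame j).mdifferentiable (by simp) x

theorem isAdaptedFrameOn (h : IsGlobalFrame S f E) : S.IsAdaptedFrameOn E Set.univ where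
  contMDiffOn i := (h.contMDiff_frame i).contMDiffOn
  adapted x _ := by
    have e : ∀ i, S.g.inner x (E i x) = f i x := fun i => by
      ext v
      rw [S.g.symm, h.inner_frame]
    simp only [e]
    exact h.adapted x

end IsGlobalFrame

end AlmostContactMetric

/-! ### Differentiating sums of products of functions. -/

section

variable {n : ℕ} {M : Type*} [TopologicalSpace M] [ChartedSpace (Euc n) M]

theorem mvfderiv_apply_congr {a b : M → ℝ} {x : M} (hab : a =ᶠ[nhds x] b)
    (v : TangentSpace (𝓡 n) x) : mvfderiv (𝓡 n) a x v = mvfderiv (𝓡 n) b x v :=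
  DFunLike.congr_fun (F := Euc n →L[ℝ] ℝ) hab.mfderiv_eq v

theorem mvfderiv_sum_mul {ι : Type*} {s : Finset ι} {a b : ι → M → ℝ} {x : M}
    (ha : ∀ i, MDifferentiableAt (𝓡 n) 𝓘(ℝ, ℝ) (a i) x)
    (hb : ∀ i, MDifferentiableAt (𝓡 n) 𝓘(ℝ, ℝ) (b i) x) (v : TangentSpace (𝓡 n) x) :
    mvfderiv (𝓡 n) (fun y => ∑ i ∈ s, a i y * b i y) x v =
      ∑ i ∈ s, (a i x * mvfderiv (𝓡 n) (b i) x v + mvfderiv (𝓡 n) (a i) x v * b i x) := by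
  classical
  have key : ∀ s : Finset ι, MDifferentiableAt (𝓡 n) 𝓘(ℝ, ℝ) (fun y => ∑ i ∈ s, a i y * b i y) x ∧
      mvfderiv (𝓡 n) (fun y => ∑ i ∈ s, a i y * b i y) x v =
      ∑ i ∈ s, (a i x * mvfderiv (𝓡 n) (b i) x v + mvfderiv (𝓡 n) (a i) x v * b i x) := by
    intro s
    induction s using Finset.induction_on with
    | empty =>
      simp only [Finset.sum_empty]
      refine ⟨mdifferentiableAt_const, ?_⟩
      rw [mvfderiv_const]
      rfl
    | insert i s hi ih =>
      simp only [Finset.sum_insert hi]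
      have hm : MDifferentiableAt (𝓡 n) 𝓘(ℝ, ℝ) (fun y => a i y * b i y) x := (ha i).mul (hb i)
      refine ⟨hm.add ih.1, ?_⟩
      rw [mvfderiv_fun_add hm ih.1, mvfderiv_fun_mul (ha i) (hb i), add_apply, ih.2]
      simp [mul_comm]
  exact (key s).2

end

/-! ### The Levi-Civita connection in terms of connection forms. -/

namespace AlmostContactMetric

open scoped Topology
open VectorField

variable {M : Type*} [TopologicalSpace M] [ChartedSpace (Euc 5) M] [IsManifold (𝓡 5) ∞ M]
  {S : AlmostContactMetric M}

/-- Skew-symmetric connection forms satisfying Cartan's first structure equation. -/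
structure IsConnectionForm (f : Fin 5 → ∀ x : M, TangentSpace (𝓡 5) x →L[ℝ] ℝ)
    (Ω : ∀ x : M, Fin 5 → Fin 5 → (TangentSpace (𝓡 5) x →L[ℝ] ℝ)) : Prop where
  skew : ∀ x i j v, Ω x i j v = -Ω x j i v
  structure_eq : ∀ x i v w,
    extDerivOne (f i) x v w = ∑ j, (Ω x i j v * f j x w - Ω x i j w * f j x v)

namespace IsGlobalFrame

variable {f : Fin 5 → ∀ x : M, TangentSpace (𝓡 5) x →L[ℝ] ℝ}
  {E : Fin 5 → ∀ x : M, TangentSpace (𝓡 5) x}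
  {Ω : ∀ x : M, Fin 5 → Fin 5 → (TangentSpace (𝓡 5) x →L[ℝ] ℝ)}
  {cov : CovariantDerivative (𝓡 5) (Euc 5) (fun x : M => TangentSpace (𝓡 5) x)}

/-- The covariant derivative with given connection forms, as a function on vector fields. -/
def covariantFun (E : Fin 5 → ∀ x : M, TangentSpace (𝓡 5) x)
    (f : Fin 5 → ∀ x : M, TangentSpace (𝓡 5) x →L[ℝ] ℝ)
    (Ω : ∀ x : M, Fin 5 → Fin 5 → (TangentSpace (𝓡 5) x →L[ℝ] ℝ))
    (Y : ∀ x : M, TangentSpace (𝓡 5) x) (x : M) :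
    TangentSpace (𝓡 5) x →L[ℝ] TangentSpace (𝓡 5) x :=
  ∑ i, (mvfderiv (𝓡 5) (fun y => f i y (Y y)) x
    + ∑ j, f j x (Y x) • Ω x j i).smulRight (E i x)

theorem coframe_covariantFun (h : IsGlobalFrame S f E) (Y : ∀ x : M, TangentSpace (𝓡 5) x) (x : M)
    (v : TangentSpace (𝓡 5) x) (i : Fin 5) :
    f i x (covariantFun E f Ω Y x v) =
      mvfderiv (𝓡 5) (fun y => f i y (Y y)) x v + ∑ j, f j x (Y x) * Ω x j i v := by
  simp [covariantFun, h.dual, map_sum]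

theorem isCovariantDerivativeOn_covariantFun (h : IsGlobalFrame S f E) :
    IsCovariantDerivativeOn (I := 𝓡 5) (Euc 5) (covariantFun E f Ω) Set.univ := by
  constructor
  · intro Y Z x hY hZ _
    refine ContinuousLinearMap.ext fun v => (h.adapted x).ext fun i => ?_
    have hd : (fun y => f i y ((Y + Z) y)) = fun y => f i y (Y y) + f i y (Z y) :=
      funext fun y => map_add _ _ _
    rw [add_apply, map_add, h.coframe_covariantFun, h.coframe_covariantFun,
      h.coframe_covariantFun, hd, mvfderiv_fun_add ((h.smooth i).mdifferentiableAt_apply hY)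
          ((h.smooth i).mdifferentiableAt_apply hZ)]
    simp only [Pi.add_apply, map_add, add_apply, add_mul, Finset.sum_add_distrib]
    ring
  · intro Y g x hY hg _
    refine ContinuousLinearMap.ext fun v => (h.adapted x).ext fun i => ?_
    have hd : (fun y => f i y ((g • Y) y)) = fun y => g y * f i y (Y y) :=
      funext fun y => map_smul (f i y) (g y) (Y y)
    rw [add_apply, map_add, smul_apply, map_smul, h.coframe_covariantFun, h.coframe_covariantFun,
      hd, mvfderiv_fun_mul hg ((h.smooth i).mdifferentiableAt_apply hY)]
    simp only [Pi.smul_apply', map_smul, smul_apply, add_apply, smul_eq_mul,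
      ContinuousLinearMap.smulRight_apply, mul_add, Finset.mul_sum, mul_assoc]
    ring

/-- The covariant derivative with given connection forms. -/
def covariant (h : IsGlobalFrame S f E)
    (Ω : ∀ x : M, Fin 5 → Fin 5 → (TangentSpace (𝓡 5) x →L[ℝ] ℝ)) :
    CovariantDerivative (𝓡 5) (Euc 5) (fun x : M => TangentSpace (𝓡 5) x) where
  toFun := covariantFun E f Ω
  isCovariantDerivativeOnUniv := h.isCovariantDerivativeOn_covariantFun

theorem coframe_covariant (h : IsGlobalFrame S f E) (Y : ∀ x : M, TangentSpace (𝓡 5) x) (x : M)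
    (v : TangentSpace (𝓡 5) x) (i : Fin 5) :
    f i x (h.covariant Ω Y x v) =
      mvfderiv (𝓡 5) (fun y => f i y (Y y)) x v + ∑ j, f j x (Y x) * Ω x j i v :=
  h.coframe_covariantFun Y x v i

/-- Skewness of `Ω` makes the connection metric. Cartan's first structure equation, compared with
the invariant formula for `dfᵢ`, makes it torsion-free. -/
theorem isLeviCivita_covariant (h : IsGlobalFrame S f E) (hΩ : IsConnectionForm f Ω) :
    S.IsLeviCivita (h.covariant Ω) where
  metric Y Z x v hY hZ := by
    have h1 : (fun y => S.g.inner y (Y y) (Z y)) = fun y => ∑ i, f i y (Y y) * f i y (Z y) :=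
      funext fun y => (h.adapted y).metric _ _
    have e1 : S.g.inner x (h.covariant Ω Y x v) (Z x) =
        ∑ i, f i x (h.covariant Ω Y x v) * f i x (Z x) := (h.adapted x).metric _ _
    have e2 : S.g.inner x (Y x) (h.covariant Ω Z x v) =
        ∑ i, f i x (Y x) * f i x (h.covariant Ω Z x v) := (h.adapted x).metric _ _
    rw [h1, e1, e2]
    refine (mvfderiv_sum_mul (fun i => (h.smooth i).mdifferentiableAt_apply hY)
      (fun i => (h.smooth i).mdifferentiableAt_apply hZ) v).trans ?_
    simp only [h.coframe_covariant]
    have h2 : ∑ i, ∑ j, f i x (Y x) * (f j x (Z x) * Ω x j i v) =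
        -∑ i, ∑ j, (f j x (Y x) * Ω x j i v) * f i x (Z x) := by
      rw [Finset.sum_comm, ← Finset.sum_neg_distrib]
      refine Finset.sum_congr rfl fun i _ => ?_
      rw [← Finset.sum_neg_distrib]
      exact Finset.sum_congr rfl fun j _ => by rw [hΩ.skew x i j]; ring
    simp only [mul_add, add_mul, Finset.mul_sum, Finset.sum_mul, Finset.sum_add_distrib]
    rw [h2]
    simp only [mul_comm (mvfderiv _ _ _ _)]
    ring
  torsion_free := by
    rw [CovariantDerivative.torsion_eq_zero_iff]
    intro X Y x hX hY
    refine (h.adapted x).ext fun i => ?_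
    have h1 := extDerivOne_apply_vectorField (h.smooth i) hX hY
    have h2 := hΩ.structure_eq x i (X x) (Y x)
    rw [map_sub, h.coframe_covariant, h.coframe_covariant]
    have h3 : ∀ (Z : ∀ x : M, TangentSpace (𝓡 5) x) (v : TangentSpace (𝓡 5) x),
        ∑ j, f j x (Z x) * Ω x j i v = -∑ j, Ω x i j v * f j x (Z x) := by
      intro Z v
      rw [← Finset.sum_neg_distrib]
      exact Finset.sum_congr rfl fun j _ => by rw [hΩ.skew x j i]; ring
    rw [Finset.sum_sub_distrib] at h2
    rw [h3, h3]
    linarith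

/-- Uniqueness of the connection forms of the Levi-Civita connection. -/
theorem inner_cov_frame (h : IsGlobalFrame S f E) (hΩ : IsConnectionForm f Ω)
    (hc : S.IsLeviCivita cov) (x : M) (v : TangentSpace (𝓡 5) x) (i j : Fin 5) :
    f j x (cov (E i) x v) = Ω x i j v := by
  -- The difference of the two connection matrices is skew in its last two indices because both are
  -- metric, and symmetric in its first two because both are torsion-free. Such a tensor vanishes.
  set c : Fin 5 → Fin 5 → Fin 5 → ℝ := fun k i j => f j x (cov (E i) x (E k x)) - Ω x i j (E k x)
    with hcdef
  have hconst : ∀ i j, (fun y => f i y (E j y)) = fun _ => if i = j then (1 : ℝ) else 0 :=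
    fun i j => funext fun y => h.dual y i j
  have hskew : ∀ k i j, c k i j = -c k j i := by
    intro k i j
    have h1 : mvfderiv (𝓡 5) (fun y => S.g.inner y (E i y) (E j y)) x (E k x) =
        S.g.inner x (cov (E i) x (E k x)) (E j x) + S.g.inner x (E i x) (cov (E j) x (E k x)) :=
      hc.metric (E i) (E j) x (E k x) (h.mdifferentiableAt_frame i x) (h.mdifferentiableAt_frame j x)
    have h2 : (fun y => S.g.inner y (E i y) (E j y)) = fun _ => if j = i then (1 : ℝ) else 0 :=
      funext fun y => by rw [h.inner_frame, h.dual]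
    rw [h2, h.inner_frame, S.g.symm, h.inner_frame, mvfderiv_const, zero_apply] at h1
    simp only [hcdef]
    linarith [hΩ.skew x i j (E k x)]
  have hsymm : ∀ k i j, c k i j = c i k j := by
    intro k i j
    have ht := (CovariantDerivative.torsion_eq_zero_iff cov).1 hc.torsion_free
      (h.mdifferentiableAt_frame k x) (h.mdifferentiableAt_frame i x)
    have h1 := extDerivOne_apply_vectorField (h.smooth j) (h.mdifferentiableAt_frame k x)
      (h.mdifferentiableAt_frame i x)
    have h2 := hΩ.structure_eq x j (E k x) (E i x)
    simp only [hconst, mvfderiv_const] at h1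
    rw [h1, ← ht] at h2
    simp [h.dual] at h2
    simp only [hcdef]
    have e1 := hΩ.skew x j i (E k x)
    have e2 := hΩ.skew x j k (E i x)
    linarith
  have hzero : ∀ k i j, c k i j = 0 := by
    intro k i j
    -- Alternating the two symmetries six times returns to `c k i j` after three sign changes.
    linarith [hsymm k i j, hskew i k j, hsymm i j k, hskew j i k, hsymm j k i, hskew k j i]
  rw [h.eq_sum x v]
  simp only [map_sum, map_smul]
  exact Finset.sum_congr rfl fun k _ => by rw [sub_eq_zero.1 (hzero k i j)]

/-- Metric compatibility tested against `E k` moves the derivative off `Y`, so only the already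
known `cov (E k)` enters. -/
theorem coframe_cov (h : IsGlobalFrame S f E) (hΩ : IsConnectionForm f Ω)
    (hc : S.IsLeviCivita cov) {Y : ∀ x : M, TangentSpace (𝓡 5) x} {x : M}
    (hY : MDifferentiableAt (𝓡 5) (𝓡 5).tangent (fun y => (⟨y, Y y⟩ : TangentBundle (𝓡 5) M)) x)
    (v : TangentSpace (𝓡 5) x) (k : Fin 5) :
    f k x (cov Y x v) =
      mvfderiv (𝓡 5) (fun y => f k y (Y y)) x v + ∑ l, f l x (Y x) * Ω x l k v := by
  have h1 : mvfderiv (𝓡 5) (fun y => S.g.inner y (Y y) (E k y)) x v =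
      S.g.inner x (cov Y x v) (E k x) + S.g.inner x (Y x) (cov (E k) x v) :=
    hc.metric Y (E k) x v hY (h.mdifferentiableAt_frame k x)
  have h2 : (fun y => S.g.inner y (Y y) (E k y)) = fun y => f k y (Y y) :=
    funext fun y => h.inner_frame y _ k
  rw [h2, h.inner_frame, (h.adapted x).metric (Y x)] at h1
  have h3 : ∑ l, f l x (Y x) * f l x (cov (E k) x v) = -∑ l, f l x (Y x) * Ω x l k v := by
    rw [← Finset.sum_neg_distrib]
    exact Finset.sum_congr rfl fun l _ => by rw [h.inner_cov_frame hΩ hc, hΩ.skew x k l]; ring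
  rw [h1, h3]
  ring

end IsGlobalFrame

end AlmostContactMetric

/-! ### Change of adapted frame. -/

namespace AlmostContactMetric

open scoped Topology

variable {M : Type*} [TopologicalSpace M] [ChartedSpace (Euc 5) M] [IsManifold (𝓡 5) ∞ M]
  {S : AlmostContactMetric M}

theorem wedge_add_wedge_eq {V : Type*} [AddCommGroup V] [Module ℝ V] [TopologicalSpace V]
    (e : Fin 5 → (V →L[ℝ] ℝ)) (v w : V) :
    wedge (e 0) (e 1) v w + wedge (e 2) (e 3) v w = ∑ k, (∑ i, e i v * Phi0 i k) * e k w := by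
  simp [wedge, Phi0, Fin.sum_univ_five]
  ring

/-- The transition matrix between two adapted coframes lies in `U(2)`. -/
theorem IsAdaptedCoframeAt.isUnitary2 {x : M} {f e : Fin 5 → (TangentSpace (𝓡 5) x →L[ℝ] ℝ)}
    (hf : S.IsAdaptedCoframeAt x f) (he : S.IsAdaptedCoframeAt x e)
    {E : Fin 5 → TangentSpace (𝓡 5) x} (hE : ∀ i j, f i (E j) = if i = j then 1 else 0) :
    IsUnitary2 (Matrix.of fun i j => e i (E j)) := by
  set h : Mat5 := Matrix.of fun i j => e i (E j) with hh
  have happ : ∀ i j, h i j = e i (E j) := fun _ _ => rfl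
  have h1 : hᵀ * h = 1 := by
    ext j k
    have := (he.metric (E j) (E k)).symm.trans (hf.metric (E j) (E k))
    simpa [Matrix.mul_apply, happ, hE, Matrix.one_apply, eq_comm] using this
  have h2 : hᵀ * Phi0 * h = Phi0 := by
    ext j k
    have := (he.fundamental (E j) (E k)).symm.trans (hf.fundamental (E j) (E k))
    rw [wedge_add_wedge_eq, wedge_add_wedge_eq] at this
    simpa [Matrix.mul_apply, happ, hE] using this
  have h3 : h * hᵀ = 1 := mul_eq_one_comm.1 h1
  refine ⟨h3, ?_, fun j => ?_⟩
  -- Preservation of `Φ` gives `hᵀΦh = Φ`; multiplying by `h` on the left and using `h hᵀ = 1` turns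
  -- this into commutation.
  · nth_rewrite 1 [← h2]
    rw [← mul_assoc, ← mul_assoc, h3, one_mul]
  · have : e 4 (E j) = f 4 (E j) := by rw [← he.contact, ← hf.contact]
    rw [happ, this, hE]
    fin_cases j <;> simp [eta0]

namespace IsGlobalFrame

variable {f : Fin 5 → ∀ x : M, TangentSpace (𝓡 5) x →L[ℝ] ℝ}
  {E e : Fin 5 → ∀ x : M, TangentSpace (𝓡 5) x} {U : Set M}
  {Ω : ∀ x : M, Fin 5 → Fin 5 → (TangentSpace (𝓡 5) x →L[ℝ] ℝ)}
  {cov : CovariantDerivative (𝓡 5) (Euc 5) (fun x : M => TangentSpace (𝓡 5) x)}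

/-- The transition matrix `h i j = fⱼ(eᵢ)` from the global frame to the frame `e`. -/
def transition (f : Fin 5 → ∀ x : M, TangentSpace (𝓡 5) x →L[ℝ] ℝ)
    (e : Fin 5 → ∀ x : M, TangentSpace (𝓡 5) x) (x : M) : Mat5 :=
  Matrix.of fun i j => f j x (e i x)

theorem isUnitary2_transition (h : IsGlobalFrame S f E) (he : S.IsAdaptedFrameOn e U) {x : M}
    (hx : x ∈ U) : IsUnitary2 (transition f e x) := by
  have h1 := (h.adapted x).isUnitary2 (he.adapted x hx) (h.dual x)
  simp only [h.inner_frame] at h1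
  exact h1

theorem mdifferentiableAt_of_isAdaptedFrameOn (hU : IsOpen U) (he : S.IsAdaptedFrameOn e U)
    {x : M} (hx : x ∈ U) (i : Fin 5) :
    MDifferentiableAt (𝓡 5) (𝓡 5).tangent (fun y => (⟨y, e i y⟩ : TangentBundle (𝓡 5) M)) x :=
  ((he.contMDiffOn i).contMDiffAt (hU.mem_nhds hx)).mdifferentiableAt (by simp)

/-- The derivative of the transition matrix. -/
def transitionDeriv (f : Fin 5 → ∀ x : M, TangentSpace (𝓡 5) x →L[ℝ] ℝ)
    (e : Fin 5 → ∀ x : M, TangentSpace (𝓡 5) x) (x : M) (v : TangentSpace (𝓡 5) x) : Mat5 :=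
  Matrix.of fun i k => mvfderiv (𝓡 5) (fun y => f k y (e i y)) x v

/-- Differentiating `h hᵀ = 1` gives skewness of `dh · hᵀ`, and differentiating `hΦ = Φh` gives
commutation with `Φ`: the Maurer–Cartan form of a `U(2)`-valued map takes values in `u(2)`. -/
theorem transitionDeriv_mul_transpose_mem (h : IsGlobalFrame S f E) (hU : IsOpen U)
    (he : S.IsAdaptedFrameOn e U) {x : M} (hx : x ∈ U) (v : TangentSpace (𝓡 5) x) :
    transitionDeriv f e x v * (transition f e x)ᵀ ∈ u2 := by
  have hd : ∀ i k, MDifferentiableAt (𝓡 5) 𝓘(ℝ, ℝ) (fun y => f k y (e i y)) x := fun i k =>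
    (h.smooth k).mdifferentiableAt_apply (mdifferentiableAt_of_isAdaptedFrameOn hU he hx i)
  constructor
  · rw [mem_twoForms]
    ext i j
    have h1 : (fun y => ∑ k, f k y (e i y) * f k y (e j y)) =ᶠ[𝓝 x]
        fun _ => (1 : Mat5) i j := by
      filter_upwards [hU.mem_nhds hx] with y hy
      rw [← (h.isUnitary2_transition he hy).mul_transpose]
      rfl
    have h2 := mvfderiv_sum_mul (s := Finset.univ) (hd i) (hd j) v
    rw [mvfderiv_apply_congr h1, mvfderiv_const, zero_apply,
      Finset.sum_add_distrib] at h2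
    simp only [Matrix.transpose_apply, Matrix.mul_apply, Matrix.neg_apply, transitionDeriv,
      transition, Matrix.of_apply]
    simp only [mul_comm (f _ x (e i x))] at h2
    linarith
  · have h1 : transitionDeriv f e x v * Phi0 = Phi0 * transitionDeriv f e x v := by
      ext i j
      have h1 : (fun y => ∑ k, f k y (e i y) * Phi0 k j) =ᶠ[𝓝 x]
          fun y => ∑ k, Phi0 i k * f j y (e k y) := by
        filter_upwards [hU.mem_nhds hx] with y hy
        exact congrFun (congrFun (h.isUnitary2_transition he hy).comm i) j
      have hc : ∀ c : ℝ, MDifferentiableAt (𝓡 5) 𝓘(ℝ, ℝ) (fun _ : M => c) x :=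
        fun c => mdifferentiableAt_const
      have h2 := mvfderiv_sum_mul (s := Finset.univ) (hd i) (fun k => hc (Phi0 k j)) v
      have h3 := mvfderiv_sum_mul (s := Finset.univ) (fun k => hc (Phi0 i k))
        (fun k => hd k j) v
      rw [mvfderiv_apply_congr h1, h3] at h2
      simp only [mvfderiv_const, zero_apply, mul_zero, zero_mul, zero_add, add_zero] at h2
      exact h2.symm
    rw [mul_assoc, (h.isUnitary2_transition he hx).transpose_comm, ← mul_assoc, h1, mul_assoc]

/-- The gauge transformation law `Ω' = dh · hᵀ + h Ω hᵀ`. -/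
theorem connectionMatrix_eq (h : IsGlobalFrame S f E) (hΩ : IsConnectionForm f Ω)
    (hc : S.IsLeviCivita cov) (hU : IsOpen U) (he : S.IsAdaptedFrameOn e U) {x : M} (hx : x ∈ U)
    (v : TangentSpace (𝓡 5) x) :
    S.connectionMatrix cov e x v =
      transitionDeriv f e x v * (transition f e x)ᵀ
        + transition f e x * (Matrix.of fun i j => Ω x i j v) * (transition f e x)ᵀ := by
  ext i j
  rw [← add_mul, Matrix.mul_apply]
  refine ((h.adapted x).metric _ _).trans (Finset.sum_congr rfl fun k _ => ?_)
  rw [h.coframe_cov hΩ hc (mdifferentiableAt_of_isAdaptedFrameOn hU he hx i)]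
  simp [transitionDeriv, transition, Matrix.mul_apply]

/-- The intrinsic torsion with respect to an arbitrary adapted frame. -/
theorem intrinsicTorsion_eq_act (h : IsGlobalFrame S f E) (hΩ : IsConnectionForm f Ω)
    {T : Tensor3}
    (hT : ∀ x v, prU2Perp (Matrix.of fun i j => Ω x i j v) = ∑ k, f k x v • Matrix.of (T k))
    (hc : S.IsLeviCivita cov) (hU : IsOpen U) (he : S.IsAdaptedFrameOn e U) {x : M} (hx : x ∈ U) :
    S.intrinsicTorsion cov e x = act (transition f e x) T := by
  funext i
  have h1 : S.intrinsicTorsion cov e x i = ∑ l, transition f e x i l •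
      (transition f e x * Matrix.of (T l) * (transition f e x)ᵀ) := by
    rw [intrinsicTorsion, h.connectionMatrix_eq hΩ hc hU he hx, prU2Perp_add,
      prU2Perp_eq_zero (h.transitionDeriv_mul_transpose_mem hU he hx _), zero_add,
      (h.isUnitary2_transition he hx).prU2Perp_conj, hT, Finset.mul_sum, Finset.sum_mul]
    simp only [mul_smul_comm, smul_mul_assoc]
    rfl
  rw [h1]
  funext j k
  refine (Matrix.sum_apply j k Finset.univ _).trans ?_
  rfl

/-- If the class condition holds, evaluating it in the global frame, where `h = 1`, returns `T`
itself whatever Levi-Civita connection was supplied. Conversely the explicit connection is a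
witness, and invariance of `W` handles all other adapted frames. -/
theorem isOfClass_iff [Nonempty M] (h : IsGlobalFrame S f E) (hΩ : IsConnectionForm f Ω)
    {T : Tensor3}
    (hT : ∀ x v, prU2Perp (Matrix.of fun i j => Ω x i j v) = ∑ k, f k x v • Matrix.of (T k))
    {W : Submodule ℝ Tensor3} (hW : IsInvariant W) : S.IsOfClass W ↔ T ∈ W := by
  constructor
  · rintro ⟨cov, hc, hcl⟩
    obtain ⟨x⟩ := ‹Nonempty M›
    have h1 := hcl Set.univ E isOpen_univ h.isAdaptedFrameOn x (Set.mem_univ x)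
    rw [h.intrinsicTorsion_eq_act hΩ hT hc isOpen_univ h.isAdaptedFrameOn (Set.mem_univ x)] at h1
    have h2 : transition f E x = 1 := by
      ext i j
      rw [transition, Matrix.of_apply, h.dual, Matrix.one_apply]
      simp only [eq_comm]
    have h3 : act (transition f E x) T = T := by
      rw [h2]
      funext i j k
      simp [act, Matrix.one_apply]
    rwa [h3] at h1
  · intro hTW
    refine ⟨h.covariant Ω, h.isLeviCivita_covariant hΩ, fun U e hU he x hx => ?_⟩
    rw [h.intrinsicTorsion_eq_act hΩ hT (h.isLeviCivita_covariant hΩ) hU he hx]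
    exact hW _ (h.isUnitary2_transition he hx) _ hTW

end IsGlobalFrame

end AlmostContactMetric

/-! ### The explicit connection forms. -/

/-- The endomorphism of `ℝ⁵` by which the form `A₂` enters the connection matrix. -/
def gaugeMatrix : Mat5 :=
  !![0, 1, 0, 0, 0;
     -1, 0, 0, 0, 0;
     0, 0, 0, -1, 0;
     0, 0, 1, 0, 0;
     0, 0, 0, 0, 0]

theorem gaugeMatrix_mem_u2 : gaugeMatrix ∈ u2 := by
  constructor
  · rw [mem_twoForms]
    ext i j
    fin_cases i <;> fin_cases j <;> simp [gaugeMatrix]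
  · ext i j
    fin_cases i <;> fin_cases j <;>
      simp [gaugeMatrix, Phi0, Matrix.mul_apply, Fin.sum_univ_five]

theorem torsionModel_skew (a₁ a₂ a₃ a₄ : ℝ) (k i j : Fin 5) :
    torsionModel a₁ a₂ a₃ a₄ k i j = -torsionModel a₁ a₂ a₃ a₄ k j i := by
  have h : ∀ a b i j, betaForm a b i j = -betaForm a b j i := fun a b i j =>
    congrFun (congrFun (betaForm_skew a b) j) i
  simp only [torsionModel_apply, etaWedge, LinearMap.coe_mk, AddHom.coe_mk]
  rw [h a₁ a₂ i j, h a₁ a₂ j k, h a₁ a₂ k i, h a₃ a₄ i j, h a₃ a₄ j k, h a₃ a₄ k i]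
  ring

/-- The projection fixes a matrix `X` once `Φ²XΦ² = ΦXΦ`. The slice at `e₅` is in `Λ²₂` and
anticommutes with `Φ`; the other slices have the form `e₅ ∧ γ`, for which both products vanish since
`Φ` kills `e₅`. -/
theorem prU2Perp_torsionModel (a₁ a₂ a₃ a₄ : ℝ) (k : Fin 5) :
    prU2Perp (Matrix.of (torsionModel a₁ a₂ a₃ a₄ k)) =
      Matrix.of (torsionModel a₁ a₂ a₃ a₄ k) := by
  have h : Phi0 * Phi0 * Matrix.of (torsionModel a₁ a₂ a₃ a₄ k) * (Phi0 * Phi0) =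
      Phi0 * Matrix.of (torsionModel a₁ a₂ a₃ a₄ k) * Phi0 := by
    have hP : Phi0 * Phi0 = Matrix.diagonal ![-1, -1, -1, -1, 0] := by
      ext i j
      fin_cases i <;> fin_cases j <;> simp [Phi0, Matrix.mul_apply, Fin.sum_univ_five]
    rw [hP]
    ext i j
    rw [Matrix.mul_diagonal, Matrix.diagonal_mul]
    simp only [Matrix.mul_apply, Fin.sum_univ_five, Matrix.of_apply, torsionModel_apply, etaWedge,
      LinearMap.coe_mk, AddHom.coe_mk]
    fin_cases i <;> fin_cases j <;> simp [Phi0, betaForm, eta0] <;> ring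
  rw [prU2Perp, h, sub_self, smul_zero, sub_zero]

section ConnectionForm

variable {V : Type*} [AddCommGroup V] [Module ℝ V] [TopologicalSpace V]

/-- The connection forms built from linear forms `f₁, …, f₅` and `A₂`. -/
def connectionForm (a₁ a₂ a₃ a₄ : ℝ) (f : Fin 5 → (V →L[ℝ] ℝ)) (A : V →L[ℝ] ℝ) (i j : Fin 5) :
    V →L[ℝ] ℝ :=
  gaugeMatrix i j • A + ∑ k, torsionModel a₁ a₂ a₃ a₄ k i j • f k

theorem connectionForm_apply (a₁ a₂ a₃ a₄ : ℝ) (f : Fin 5 → (V →L[ℝ] ℝ)) (A : V →L[ℝ] ℝ)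
    (i j : Fin 5) (v : V) : connectionForm a₁ a₂ a₃ a₄ f A i j v =
      gaugeMatrix i j * A v + ∑ k, torsionModel a₁ a₂ a₃ a₄ k i j * f k v := by
  simp [connectionForm]

theorem prU2Perp_connectionForm (a₁ a₂ a₃ a₄ : ℝ) (f : Fin 5 → (V →L[ℝ] ℝ)) (A : V →L[ℝ] ℝ)
    (v : V) : prU2Perp (Matrix.of fun i j => connectionForm a₁ a₂ a₃ a₄ f A i j v) =
      ∑ k, f k v • Matrix.of (torsionModel a₁ a₂ a₃ a₄ k) := by
  have h : (Matrix.of fun i j => connectionForm a₁ a₂ a₃ a₄ f A i j v) =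
      A v • gaugeMatrix + ∑ k, f k v • Matrix.of (torsionModel a₁ a₂ a₃ a₄ k) := by
    ext i j
    rw [Matrix.of_apply, connectionForm_apply, Matrix.add_apply, Matrix.sum_apply]
    simp [mul_comm]
  rw [h, prU2Perp_add, prU2Perp_smul, prU2Perp_eq_zero gaugeMatrix_mem_u2, smul_zero, zero_add,
    prU2Perp_sum]
  simp only [prU2Perp_smul, prU2Perp_torsionModel]

theorem connectionForm_skew (a₁ a₂ a₃ a₄ : ℝ) (f : Fin 5 → (V →L[ℝ] ℝ)) (A : V →L[ℝ] ℝ)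
    (i j : Fin 5) (v : V) :
    connectionForm a₁ a₂ a₃ a₄ f A i j v = -connectionForm a₁ a₂ a₃ a₄ f A j i v := by
  have h : gaugeMatrix i j = -gaugeMatrix j i := congrFun (congrFun gaugeMatrix_mem_u2.1 j) i
  simp only [connectionForm_apply, h, torsionModel_skew a₁ a₂ a₃ a₄ _ i j, neg_mul,
    Finset.sum_neg_distrib]
  ring

/-- This fixes the choice of `T`. In the first four equations, `e₅`-slices contribute `a₁ + 2a₃` and
the entries `Ωᵢ₅` contribute `a₁ - a₃`, adding up to `2a₁ + a₃`; in the last equation only the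
latter occur, twice. The pair `a₂, a₄` behaves likewise. -/
theorem sum_connectionForm (a₁ a₂ a₃ a₄ : ℝ) (f : Fin 5 → (V →L[ℝ] ℝ)) (A : V →L[ℝ] ℝ)
    (v w : V) (i : Fin 5) :
    ∑ j, (connectionForm a₁ a₂ a₃ a₄ f A i j v * f j w
      - connectionForm a₁ a₂ a₃ a₄ f A i j w * f j v) =
    (![wedge A (f 1) - (2 * a₁ + a₃) • wedge (f 2) (f 4) - (2 * a₂ + a₄) • wedge (f 3) (f 4),
      -wedge A (f 0) + (2 * a₁ + a₃) • wedge (f 3) (f 4) - (2 * a₂ + a₄) • wedge (f 2) (f 4),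
      -wedge A (f 3) + (2 * a₁ + a₃) • wedge (f 0) (f 4) + (2 * a₂ + a₄) • wedge (f 1) (f 4),
      wedge A (f 2) - (2 * a₁ + a₃) • wedge (f 1) (f 4) + (2 * a₂ + a₄) • wedge (f 0) (f 4),
      -(2 * (a₁ - a₃)) • (wedge (f 0) (f 2) - wedge (f 1) (f 3))
        - (2 * (a₂ - a₄)) • (wedge (f 0) (f 3) + wedge (f 1) (f 2))] : Fin 5 → V → V → ℝ) i v w := by
  simp only [connectionForm_apply, torsionModel_apply, Fin.sum_univ_five, etaWedge,
    LinearMap.coe_mk, AddHom.coe_mk]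
  fin_cases i <;>
    simp [gaugeMatrix, betaForm, eta0, wedge] <;> ring

end ConnectionForm

/-! ### Restriction of the structure equations to the submanifold. -/

section Submanifold

variable {a₁ a₂ a₃ a₄ : ℝ} {G : Type*} [TopologicalSpace G] [ChartedSpace (Euc 6) G] [Group G]
  [LieGroup (𝓡 6) ∞ G] {M : Type*} [TopologicalSpace M] [ChartedSpace (Euc 5) M]
  [IsManifold (𝓡 5) ∞ M] {ι : M → G} {e : Fin 5 → ∀ y : G, TangentSpace (𝓡 6) y →L[ℝ] ℝ}
  {A : ∀ y : G, TangentSpace (𝓡 6) y →L[ℝ] ℝ}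

theorem StructureEquations.isConnectionForm_pullback (h : StructureEquations a₁ a₂ a₃ a₄ e A)
    (he : ∀ i, IsSmoothForm (e i)) (hι : ContMDiff (𝓡 5) (𝓡 6) ∞ ι) :
    AlmostContactMetric.IsConnectionForm (fun i => pullbackForm 5 6 ι (e i))
      (fun x => connectionForm a₁ a₂ a₃ a₄ (fun i => pullbackForm 5 6 ι (e i) x)
        (pullbackForm 5 6 ι A x)) where
  skew x i j v := connectionForm_skew _ _ _ _ _ _ i j v
  structure_eq x i v w := by
    rw [sum_connectionForm, extDerivOne_pullbackForm (he i) hι]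
    fin_cases i
    · exact congrFun (congrFun (h.d_e₁ (ι x)) _) _
    · exact congrFun (congrFun (h.d_e₂ (ι x)) _) _
    · exact congrFun (congrFun (h.d_e₃ (ι x)) _) _
    · exact congrFun (congrFun (h.d_e₄ (ι x)) _) _
    · exact congrFun (congrFun (h.d_e₅ (ι x)) _) _

end Submanifold

end AlmostContact

end

theorem mainTheorem7 (a₁ a₂ a₃ a₄ : ℝ) (ha : a₁ * a₄ = a₂ * a₃)
    {G : Type*} [TopologicalSpace G] [ChartedSpace (AlmostContact.Euc 6) G] [Group G]
    [LieGroup (𝓡 6) ∞ G]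
    (b : Module.Basis (Fin 6) ℝ (AlmostContact.leftInvariantForms 6 G))
    (hb : AlmostContact.StructureEquations a₁ a₂ a₃ a₄ (fun i : Fin 5 => (b i.castSucc).1) (b 5).1)
    {M : Type*} [Nonempty M] [TopologicalSpace M] [ChartedSpace (AlmostContact.Euc 5) M]
    [IsManifold (𝓡 5) ∞ M]
    (ι : M → G) (hι : ContMDiff (𝓡 5) (𝓡 6) ∞ ι) (hι_inj : Function.Injective ι)
    (hli : ∀ x : M, LinearIndependent ℝ
      (fun i : Fin 5 => AlmostContact.pullbackForm 5 6 ι (b i.castSucc).1 x))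
    (S : AlmostContact.AlmostContactMetric M)
    (hS : ∀ x : M, S.IsAdaptedCoframeAt x
      (fun i : Fin 5 => AlmostContact.pullbackForm 5 6 ι (b i.castSucc).1 x)) :
    S.IsOfClass (AlmostContact.W4 ⊔ AlmostContact.W7) ∧
    (S.IsOfClass AlmostContact.W4 ↔ a₃ = 0 ∧ a₄ = 0) ∧
    (S.IsOfClass AlmostContact.W7 ↔ a₁ = 0 ∧ a₂ = 0) := by
  open AlmostContact in
  have hsm : ∀ i : Fin 5, IsSmoothForm (b i.castSucc).1 := fun i =>
    isSmoothForm_of_mem_leftInvariantForms (b i.castSucc).2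
  obtain ⟨E, hE⟩ := AlmostContact.AlmostContactMetric.exists_isGlobalFrame
    (fun i => (hsm i).pullbackForm hι) hS
  -- All three claims become membership questions about one constant tensor.
  have hiff : ∀ W, AlmostContact.IsInvariant W →
      (S.IsOfClass W ↔ AlmostContact.torsionModel a₁ a₂ a₃ a₄ ∈ W) := fun W hW =>
    hE.isOfClass_iff (hb.isConnectionForm_pullback hsm hι)
      (fun x v => AlmostContact.prU2Perp_connectionForm a₁ a₂ a₃ a₄ _ _ v) hW
  rw [hiff _ (AlmostContact.isInvariant_W4.sup AlmostContact.isInvariant_W7),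
    hiff _ AlmostContact.isInvariant_W4, hiff _ AlmostContact.isInvariant_W7]
  exact ⟨AlmostContact.torsionModel_mem_sup a₁ a₂ a₃ a₄,
    AlmostContact.torsionModel_mem_W4_iff a₁ a₂ a₃ a₄,
    AlmostContact.torsionModel_mem_W7_iff a₁ a₂ a₃ a₄⟩
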